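/- Let $(\Omega,\mathcal F,P)$ be a probability space and $d\ge 1$. A loss function is a map $\ell:\mathbb R^d\to(-\infty,\infty]$ that is increasing for the componentwise order, convex, lower semicontinuous, satisfies $\inf \ell<0$, and satisfies $\ell(x)\ge \sum_k x_k-c$ for all $x\in\mathbb R^d$ and some constant $c\in\mathbb R$. It is permutation invariant if $\ell(\pi(x))=\ell(x)$ for every permutation $\pi$ of the components. Let $M^\theta$ be the set of random vectors $X:\Omega\to\mathbb R^d$ with $E[\ell(r|X|)]<\infty$ for all $r\ge 0$, where $|\cdot|$ is the componentwise absolute value. For $X,Y\in M^\theta$ put $$A(X)=\{m\in\mathbb R^d: E[\ell(X-m)]\le 0\},\qquad R(X)=\inf\Big\{\sum_k m_k: m\in A(X)\Big\},\qquad R(X;Y)=\limsup_{t\searrow 0}\frac{R(X+tY)-R(X)}{t}.$$ A risk allocation of $X$ is an $m\in A(X)$ with $\sum_k m_k=R(X)$; if it is unique it is denoted by $RA(X)$. Let $L(m,\lambda,X)=\sum_k m_k+\lambda E[\ell(X-m)]$. The set of saddle points of $L(\cdot,\cdot,X)$ (minimum in $m\in\mathbb R^d$, maximum in $\lambda>0$)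 is a product set, which is denoted by $B(X)\times C(X)$. Theorem. Let $\ell$ be a permutation invariant loss function and $X,Y\in M^\theta$, and suppose that, for every risk allocation $m$ of $X$, almost surely $\ell$ is finite near $X-m$ and differentiable at $X-m$. Then $B(X)$ and $C(X)$ are nonempty, $\nabla\ell(X-m)\cdot Y$ is integrable for every $m\in B(X)$, $R(X;Y)$ is a real number, and $$R(X;Y)=\min_{m\in B(X)}\max_{\lambda\in C(X)}\lambda\,E[\nabla\ell(X-m)\cdot Y],$$ where the minimum and the maxima are attained. Suppose further that $\ell$ is finite and of class $C^2$ on $\mathbb R^d$, and that $(m,\lambda)\in B(X)\times C(X)$ is such that, for some $\delta>0$, the random variables $\|\nabla^2\ell(X+tY-m')\|\,(1+\|Y\|)$, for $\|m'-m\|<\delta$ and $|t|<\delta$, are all dominated, outside a common null set, by one integrable random variable, and such that the $(d+1)\times(d+1)$ matrix $$M=\begin{bmatrix}\lambda E[\nabla^2\ell(X-m)] & -\tfrac1\lambda \mathbf 1\\ \mathbf 1^{\top} & 0\end{bmatrix},\qquad \mathbf 1=(1,\dots,1)^\top,$$ is nonsingular. Then there is $t_0>0$ such that, for every $0\le t\le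 t_0$, the risk allocation of $X+tY$ is unique and $B(X+tY)\times C(X+tY)$ consists of a single point $(RA(X+tY),\lambda_t)$; the map $t\mapsto (RA(X+tY),\lambda_t)$ is differentiable on $[0,t_0]$ (one-sided at the end points); and, with $$RA_k(X;Y)=\limsup_{t\searrow 0}\frac{RA_k(X+tY)-RA_k(X)}{t},\qquad \lambda(X;Y)=\limsup_{t\searrow0}\frac{\lambda_t-\lambda_0}{t},$$ its derivative at $t=0$ is $$\begin{bmatrix}RA(X;Y)\\ \lambda(X;Y)\end{bmatrix}=M^{-1}V,\qquad V=\begin{bmatrix}\lambda E[\nabla^2\ell(X-m)\,Y]\\ R(X;Y)\end{bmatrix}.$$ -/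

import Mathlib

open MeasureTheory Filter Topology Set

namespace ShortfallRisk

/-- A loss function `ℓ : ℝ^d → (-∞, ∞]`. The value `-∞` is excluded by the last condition. -/
structure IsLossFunction {d : ℕ} (ℓ : (Fin d → ℝ) → EReal) : Prop where
  increasing : Monotone ℓ
  convex : ∀ (x y : Fin d → ℝ) (a b : ℝ), 0 < a → 0 < b → a + b = 1 →
    ℓ (a • x + b • y) ≤ (a : EReal) * ℓ x + (b : EReal) * ℓ y
  lsc : LowerSemicontinuous ℓ
  inf_neg : ∃ x, ℓ x < 0
  risk_averse : ∃ c : ℝ, ∀ x, ((∑ k, x k - c : ℝ) : EReal) ≤ ℓ x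

/-- `ℓ (π x) = ℓ x` for every permutation `π` of the components. -/
def PermutationInvariant {d : ℕ} (ℓ : (Fin d → ℝ) → EReal) : Prop :=
  ∀ (σ : Equiv.Perm (Fin d)) (x : Fin d → ℝ), ℓ (fun k => x (σ k)) = ℓ x

/-- Expectation of an extended real random variable, `E[f⁺] - E[f⁻]`. Whenever it is used below,
`E[f⁻]` is finite, so that the difference is meaningful. -/
noncomputable def expect {Ω : Type*} [MeasurableSpace Ω] (P : Measure Ω) (f : Ω → EReal) : EReal :=
  ((∫⁻ ω, (f ω).toENNReal ∂P : ENNReal) : EReal) - ((∫⁻ ω, (-f ω).toENNReal ∂P : ENNReal) : EReal)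

/-- The multivariate Orlicz heart `M^θ`, `θ x = ℓ |x|`, with the componentwise absolute value. -/
def orliczHeart {d : ℕ} (ℓ : (Fin d → ℝ) → EReal) {Ω : Type*} [MeasurableSpace Ω]
    (P : Measure Ω) : Set (Ω → Fin d → ℝ) :=
  {X | AEMeasurable X P ∧ ∀ r : ℝ, 0 ≤ r → expect P (fun ω => ℓ |r • X ω|) < ⊤}

section Risk

variable {d : ℕ} (ℓ : (Fin d → ℝ) → EReal) {Ω : Type*} [MeasurableSpace Ω] (P : Measure Ω)

/-- The set `A(X)` of acceptable monetary allocations. -/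
def acceptable (X : Ω → Fin d → ℝ) : Set (Fin d → ℝ) :=
  {m | expect P (fun ω => ℓ (X ω - m)) ≤ 0}

/-- The multivariate shortfall risk `R(X)`. -/
noncomputable def shortfallRisk (X : Ω → Fin d → ℝ) : EReal :=
  ⨅ m ∈ acceptable ℓ P X, ((∑ k, m k : ℝ) : EReal)

/-- `m` is a risk allocation of `X`: it is acceptable and `R(X) = ∑ m_k`. -/
def IsRiskAllocation (X : Ω → Fin d → ℝ) (m : Fin d → ℝ) : Prop :=
  m ∈ acceptable ℓ P X ∧ shortfallRisk ℓ P X = ((∑ k, m k : ℝ) : EReal)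

/-- The risk allocation `RA(X)`; meaningful if there is exactly one. -/
noncomputable def riskAllocation (X : Ω → Fin d → ℝ) : Fin d → ℝ :=
  Classical.epsilon (IsRiskAllocation ℓ P X)

/-- The marginal risk contribution `R(X;Y)`. -/
noncomputable def marginalRisk (X Y : Ω → Fin d → ℝ) : EReal :=
  limsup (fun t : ℝ => (shortfallRisk ℓ P (X + t • Y) - shortfallRisk ℓ P X) / (t : EReal))
    (𝓝[>] (0 : ℝ))

/-- The risk allocation marginals `RA_k(X;Y)`. -/
noncomputable def riskAllocationMarginal (X Y : Ω → Fin d → ℝ) (k : Fin d) : EReal :=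
  limsup (fun t : ℝ =>
    (((riskAllocation ℓ P (X + t • Y) k - riskAllocation ℓ P X k) / t : ℝ) : EReal))
    (𝓝[>] (0 : ℝ))

/-- The Lagrangian `L(m, λ, X) = ∑ m_k + λ E[ℓ(X - m)]`. -/
noncomputable def lagrangian (X : Ω → Fin d → ℝ) (m : Fin d → ℝ) (lam : ℝ) : EReal :=
  ((∑ k, m k : ℝ) : EReal) + (lam : EReal) * expect P (fun ω => ℓ (X ω - m))

/-- The saddle points `(m, λ)` of `L(·, ·, X)` for `m ∈ ℝ^d`, `λ > 0`
(minimum in `m`, maximum in `λ`). -/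
def saddleSet (X : Ω → Fin d → ℝ) : Set ((Fin d → ℝ) × ℝ) :=
  {p | 0 < p.2 ∧ (∀ lam : ℝ, 0 < lam → lagrangian ℓ P X p.1 lam ≤ lagrangian ℓ P X p.1 p.2) ∧
    ∀ m : Fin d → ℝ, lagrangian ℓ P X p.1 p.2 ≤ lagrangian ℓ P X m p.2}

/-- `B(X)`. -/
def saddleB (X : Ω → Fin d → ℝ) : Set (Fin d → ℝ) := Prod.fst '' saddleSet ℓ P X

/-- `C(X)`. -/
def saddleC (X : Ω → Fin d → ℝ) : Set ℝ := Prod.snd '' saddleSet ℓ P X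

/-- The set of saddle points is the product `B(X) × C(X)`. -/
theorem saddleSet_eq_prod (X : Ω → Fin d → ℝ) :
    saddleSet ℓ P X = saddleB ℓ P X ×ˢ saddleC ℓ P X := by
  ext ⟨m, lam⟩
  constructor
  · intro h
    exact ⟨⟨_, h, rfl⟩, ⟨_, h, rfl⟩⟩
  · rintro ⟨⟨⟨m1, l1⟩, h1, rfl⟩, ⟨⟨m2, l2⟩, h2, rfl⟩⟩
    obtain ⟨p1, a1, b1⟩ := h1
    obtain ⟨p2, a2, b2⟩ := h2
    simp only at p1 a1 b1 p2 a2 b2 ⊢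
    have e1 := b1 m2
    have e2 := a2 l1 p1
    have e3 := b2 m1
    have e4 := a1 l2 p2
    refine ⟨p2, fun lam hl => (a1 lam hl).trans ((e1.trans e2).trans e3), fun m => ?_⟩
    exact ((e4.trans e1).trans e2).trans (b2 m)

end Risk

section Derivatives

variable {d : ℕ}

/-- `ℓ` is finite near `x` and differentiable at `x`. -/
def DiffAt (ℓ : (Fin d → ℝ) → EReal) (x : Fin d → ℝ) : Prop :=
  (∀ᶠ y in 𝓝 x, ℓ y ≠ ⊤) ∧ DifferentiableAt ℝ (fun y => (ℓ y).toReal) x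

/-- The gradient `∇ℓ(x)`. -/
noncomputable def grad (ℓ : (Fin d → ℝ) → EReal) (x : Fin d → ℝ) : Fin d → ℝ :=
  fun i => fderiv ℝ (fun y => (ℓ y).toReal) x (Pi.single i 1)

/-- The Hessian matrix `∇²ℓ(x)`. -/
noncomputable def hess (ℓ : (Fin d → ℝ) → EReal) (x : Fin d → ℝ) : Matrix (Fin d) (Fin d) ℝ :=
  Matrix.of fun i j => fderiv ℝ (fun y => grad ℓ y j) x (Pi.single i 1)

/-- `ℓ` is finite and twice continuously differentiable on `ℝ^d`. -/
def IsC2 (ℓ : (Fin d → ℝ) → EReal) : Prop :=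
  (∀ x, ℓ x ≠ ⊤) ∧ ContDiff ℝ 2 (fun y => (ℓ y).toReal)

variable {Ω : Type*} [MeasurableSpace Ω] (ℓ : (Fin d → ℝ) → EReal) (P : Measure Ω)

/-- The functional `λ E[∇ℓ(X - m) · Y]`. -/
noncomputable def gradTerm (X Y : Ω → Fin d → ℝ) (m : Fin d → ℝ) (lam : ℝ) : ℝ :=
  lam * ∫ ω, grad ℓ (X ω - m) ⬝ᵥ Y ω ∂P

/-- Near `(m, 0)`, the family `∇²ℓ(X + tY - m') (1 + |Y|)` is dominated by one integrable
random variable, so that the second derivatives of `(m', t) ↦ E[ℓ(X + tY - m')]` involving `m'`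
may be taken under the expectation. -/
def HessDominated (X Y : Ω → Fin d → ℝ) (m : Fin d → ℝ) : Prop :=
  ∃ δ : ℝ, 0 < δ ∧ ∃ g : Ω → ℝ, Integrable g P ∧ ∀ᵐ ω ∂P, ∀ (m' : Fin d → ℝ) (t : ℝ),
    ‖m' - m‖ < δ → |t| < δ → ∀ i j, |hess ℓ (X ω + t • Y ω - m') i j| * (1 + ‖Y ω‖) ≤ g ω

/-- The bordered matrix `M = [[λ E[∇²ℓ(X - m)], -1/λ], [1, 0]]` of size `d + 1`. -/
noncomputable def borderedMatrix (X : Ω → Fin d → ℝ) (m : Fin d → ℝ) (lam : ℝ) :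
    Matrix (Fin d ⊕ Unit) (Fin d ⊕ Unit) ℝ :=
  Matrix.fromBlocks
    (Matrix.of fun i j => lam * ∫ ω, hess ℓ (X ω - m) i j ∂P)
    (Matrix.of fun _ _ => -(1 / lam))
    (Matrix.of fun _ _ => 1)
    0

/-- The vector `V = [λ E[∇²ℓ(X - m) Y], R(X;Y)]`. -/
noncomputable def rhsVector (X Y : Ω → Fin d → ℝ) (m : Fin d → ℝ) (lam : ℝ) :
    Fin d ⊕ Unit → ℝ :=
  Sum.elim (fun i => lam * ∫ ω, (Matrix.mulVec (hess ℓ (X ω - m)) (Y ω)) i ∂P)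
    (fun _ => (marginalRisk ℓ P X Y).toReal)

end Derivatives

end ShortfallRisk

namespace ShortfallRisk

/-! The problem is a convex program in `ℝ^d` with the single constraint `E[ℓ(X - m)] ≤ 0`, and the
theorem is its sensitivity analysis.

Existence of a risk allocation needs compactness. By Jensen an allocation acceptable for `X` is
acceptable for the constant `E[X]`, so it is enough to bound deterministic allocations with bounded
total. If these are unbounded, `ℓ` has a nonzero recession direction of total zero; permutation
invariance then puts every zero-sum vector into the recession cone, `ℓ` depends on the sum of the
components only, and one may restrict to allocations with equal components
(`exists_isRiskAllocation`).

Slopes of convex functions are monotone, so the expected loss can be differentiated under the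
expectation by domination. With a Slater point this gives the Karush-Kuhn-Tucker conditions: the
saddle points are the pairs with `λ > 0`, `λ E[∂_k ℓ(X - m)] = 1` for all `k`, and `E[ℓ(X - m)] =
0`. Put `q = λ E[∇ℓ(X - m) · Y]`. The gradient inequality multiplied by `λ` gives `R(X + tY) ≥ R(X)
+ tq`, and moving `m` in a direction of total `q + ε` gives the matching upper bound. Hence `q =
R(X;Y)` at every saddle point, and the min-max is taken over a constant function
(`RegularAt.marginalRisk_eq`).

For the curve of saddle points, the inverse function theorem is applied to the first order
conditions with `t` adjoined as a component (`focMap`). Up to signs and the scaling of the last row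
by `1/λ`, their derivative in `(m, λ)` is the bordered matrix. Local uniqueness becomes global
because the risk allocations form a convex set: a second one would produce further zeros arbitrarily
close to the first. Differentiating the conditions along the curve yields `M c' = V`. -/

theorem abs_le_abs_add_abs_of_le_of_le {a b c : ℝ} (h1 : a ≤ c) (h2 : c ≤ b) :
    |c| ≤ |b| + |a| :=
  abs_le.2 ⟨by linarith [neg_abs_le a, abs_nonneg b], by linarith [le_abs_self b, abs_nonneg a]⟩

/-! ### Convexity of the loss along rays. -/

section LossFunction

variable {d : ℕ} {ℓ : (Fin d → ℝ) → EReal}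

theorem IsLossFunction.ne_bot (h : IsLossFunction ℓ) (x : Fin d → ℝ) : ℓ x ≠ ⊥ := by
  obtain ⟨c, hc⟩ := h.risk_averse
  intro hx
  have := hc x
  rw [hx, le_bot_iff] at this
  exact EReal.coe_ne_bot _ this

theorem IsLossFunction.coe_toReal (h : IsLossFunction ℓ) {x : Fin d → ℝ} (hx : ℓ x ≠ ⊤) :
    (((ℓ x).toReal : ℝ) : EReal) = ℓ x :=
  EReal.coe_toReal hx (h.ne_bot x)

theorem IsLossFunction.ne_top_of_le (h : IsLossFunction ℓ) {x y : Fin d → ℝ} (hxy : x ≤ y)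
    (hy : ℓ y ≠ ⊤) : ℓ x ≠ ⊤ :=
  ne_top_of_le_ne_top hy (h.increasing hxy)

theorem IsLossFunction.toReal_mono (h : IsLossFunction ℓ) {x y : Fin d → ℝ} (hxy : x ≤ y)
    (hy : ℓ y ≠ ⊤) : (ℓ x).toReal ≤ (ℓ y).toReal :=
  EReal.toReal_le_toReal (h.increasing hxy) (h.ne_bot x) hy

theorem IsLossFunction.toReal_convex (h : IsLossFunction ℓ) {x y : Fin d → ℝ} {a b : ℝ}
    (hx : ℓ x ≠ ⊤) (hy : ℓ y ≠ ⊤) (ha : 0 ≤ a) (hb : 0 ≤ b) (hab : a + b = 1) :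
    ℓ (a • x + b • y) ≠ ⊤ ∧
      (ℓ (a • x + b • y)).toReal ≤ a * (ℓ x).toReal + b * (ℓ y).toReal := by
  rcases ha.eq_or_lt with rfl | ha
  · obtain rfl : b = 1 := by linarith
    simp [hy]
  rcases hb.eq_or_lt with rfl | hb
  · obtain rfl : a = 1 := by linarith
    simp [hx]
  have key := h.convex x y a b ha hb hab
  rw [← h.coe_toReal hx, ← h.coe_toReal hy] at key
  have key' : ℓ (a • x + b • y) ≤ ((a * (ℓ x).toReal + b * (ℓ y).toReal : ℝ) : EReal) := by
    exact_mod_cast key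
  have ht : ℓ (a • x + b • y) ≠ ⊤ := ne_top_of_le_ne_top (EReal.coe_ne_top _) key'
  refine ⟨ht, ?_⟩
  rw [← h.coe_toReal ht] at key'
  exact_mod_cast key'

theorem IsLossFunction.exists_le_toReal (h : IsLossFunction ℓ) :
    ∃ c : ℝ, ∀ x, ℓ x ≠ ⊤ → ∑ k, x k - c ≤ (ℓ x).toReal := by
  obtain ⟨c, hc⟩ := h.risk_averse
  refine ⟨c, fun x hx => ?_⟩
  have := hc x
  rw [← h.coe_toReal hx] at this
  exact_mod_cast this

theorem IsLossFunction.measurable_toReal (h : IsLossFunction ℓ) :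
    Measurable fun x => (ℓ x).toReal :=
  h.lsc.measurable.ereal_toReal

theorem grad_dotProduct (ℓ : (Fin d → ℝ) → EReal) (x h : Fin d → ℝ) :
    grad ℓ x ⬝ᵥ h = fderiv ℝ (fun y => (ℓ y).toReal) x h := by
  conv_rhs => rw [pi_eq_sum_univ' h]
  simp only [dotProduct, grad, map_sum, map_smul, smul_eq_mul]
  refine Finset.sum_congr rfl fun i _ => ?_
  rw [mul_comm]

/-- Difference quotients of a loss function along a ray converge to the directional derivative. -/
theorem DiffAt.tendsto_quotient {x : Fin d → ℝ} (hx : DiffAt ℓ x) (h : Fin d → ℝ) :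
    Tendsto (fun t : ℝ => ((ℓ (x + t • h)).toReal - (ℓ x).toReal) / t) (𝓝[≠] 0)
      (𝓝 (grad ℓ x ⬝ᵥ h)) := by
  rw [grad_dotProduct]
  have h1 : HasDerivAt (fun t : ℝ => (ℓ (x + t • h)).toReal)
      (fderiv ℝ (fun y => (ℓ y).toReal) x h) 0 := by
    have h2 : HasDerivAt (fun t : ℝ => x + t • h) h 0 := by
      simpa using ((hasDerivAt_id (0 : ℝ)).smul_const h).const_add x
    have h3 : HasFDerivAt (fun y => (ℓ y).toReal) (fderiv ℝ (fun y => (ℓ y).toReal) x)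
        (x + (0 : ℝ) • h) := by
      simpa using hx.2.hasFDerivAt
    exact h3.comp_hasDerivAt 0 h2
  have h4 := h1.tendsto_slope
  refine h4.congr fun t => ?_
  simp [slope_def_field]

/-- Slopes from `x` decrease as the step shrinks, so their limit at step `0` lies below each of
them. -/
theorem IsLossFunction.grad_dotProduct_le (hℓ : IsLossFunction ℓ) {x h : Fin d → ℝ}
    (hx : DiffAt ℓ x) {t : ℝ} (ht : 0 < t) (hy : ℓ (x + t • h) ≠ ⊤) :
    grad ℓ x ⬝ᵥ h ≤ ((ℓ (x + t • h)).toReal - (ℓ x).toReal) / t := by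
  have hx0 : ℓ x ≠ ⊤ := hx.1.self_of_nhds
  have h1 := (hx.tendsto_quotient h).mono_left
    (nhdsWithin_mono (0 : ℝ) (fun s (hs : 0 < s) => hs.ne') : 𝓝[>] (0 : ℝ) ≤ 𝓝[≠] 0)
  refine le_of_tendsto h1 ?_
  filter_upwards [Ioo_mem_nhdsGT ht] with s hs
  have hs0 : 0 < s / t := div_pos hs.1 ht
  have hs1 : s / t < 1 := (div_lt_one ht).2 hs.2
  have := (hℓ.toReal_convex hx0 hy (a := 1 - s / t) (b := s / t) (by linarith) hs0.le
    (by ring)).2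
  have e : (1 - s / t) • x + (s / t) • (x + t • h) = x + s • h := by
    ext i
    simp
    field_simp
    ring
  rw [e] at this
  rw [div_le_div_iff₀ hs.1 ht]
  have h5 : (ℓ (x + s • h)).toReal - (ℓ x).toReal ≤
      s / t * ((ℓ (x + t • h)).toReal - (ℓ x).toReal) := by linarith
  calc _ ≤ s / t * ((ℓ (x + t • h)).toReal - (ℓ x).toReal) * t := by gcongr
    _ = _ := by field_simp

theorem IsLossFunction.le_grad_dotProduct (hℓ : IsLossFunction ℓ) {x h : Fin d → ℝ}
    (hx : DiffAt ℓ x) {t : ℝ} (ht : 0 < t) (hy : ℓ (x - t • h) ≠ ⊤) :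
    ((ℓ x).toReal - (ℓ (x - t • h)).toReal) / t ≤ grad ℓ x ⬝ᵥ h := by
  have := hℓ.grad_dotProduct_le (h := -h) hx ht (by simpa [← sub_eq_add_neg] using hy)
  rw [dotProduct_neg, smul_neg, ← sub_eq_add_neg] at this
  rw [← neg_sub, neg_div]
  linarith

theorem IsLossFunction.quotient_mono (hℓ : IsLossFunction ℓ) {x h : Fin d → ℝ}
    (hx0 : ℓ x ≠ ⊤) {s t : ℝ} (hs : 0 < s) (hst : s ≤ t) (hy : ℓ (x + t • h) ≠ ⊤) :
    ((ℓ (x + s • h)).toReal - (ℓ x).toReal) / s ≤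
      ((ℓ (x + t • h)).toReal - (ℓ x).toReal) / t := by
  have ht : 0 < t := hs.trans_le hst
  have hs1 : s / t ≤ 1 := (div_le_one ht).2 hst
  have := (hℓ.toReal_convex hx0 hy (a := 1 - s / t) (b := s / t) (by linarith) (by positivity)
    (by ring)).2
  have e : (1 - s / t) • x + (s / t) • (x + t • h) = x + s • h := by
    ext i
    simp
    field_simp
    ring
  rw [e] at this
  rw [div_le_div_iff₀ hs ht]
  have h5 : (ℓ (x + s • h)).toReal - (ℓ x).toReal ≤
      s / t * ((ℓ (x + t • h)).toReal - (ℓ x).toReal) := by linarith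
  calc _ ≤ s / t * ((ℓ (x + t • h)).toReal - (ℓ x).toReal) * t := by gcongr
    _ = _ := by field_simp

end LossFunction

/-! ### Expected losses: finiteness, convexity and directional derivatives. -/

section FiniteExpectation

variable {d : ℕ} {ℓ : (Fin d → ℝ) → EReal} {Ω : Type*} [MeasurableSpace Ω] {P : Measure Ω}

/-- The random variable `ℓ(Z)` is almost surely finite and integrable. -/
def FinExp (ℓ : (Fin d → ℝ) → EReal) (P : Measure Ω) (Z : Ω → Fin d → ℝ) : Prop :=
  (∀ᵐ ω ∂P, ℓ (Z ω) ≠ ⊤) ∧ Integrable (fun ω => (ℓ (Z ω)).toReal) P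

theorem FinExp.congr {Z W : Ω → Fin d → ℝ} (h : FinExp ℓ P Z) (hZW : Z =ᵐ[P] W) :
    FinExp ℓ P W := by
  constructor
  · filter_upwards [h.1, hZW] with ω h1 h2
    rwa [← h2]
  · refine h.2.congr ?_
    filter_upwards [hZW] with ω h2
    rw [h2]

theorem expect_congr {f g : Ω → EReal} (h : f =ᵐ[P] g) : expect P f = expect P g := by
  unfold expect
  have h1 : (fun ω => (f ω).toENNReal) =ᵐ[P] fun ω => (g ω).toENNReal :=
    h.mono fun ω h => by simp only [h]
  have h2 : (fun ω => (-f ω).toENNReal) =ᵐ[P] fun ω => (-g ω).toENNReal :=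
    h.mono fun ω h => by simp only [h]
  rw [lintegral_congr_ae h1, lintegral_congr_ae h2]

theorem expect_eq_integral (hℓ : IsLossFunction ℓ) {Z : Ω → Fin d → ℝ} (h : FinExp ℓ P Z) :
    expect P (fun ω => ℓ (Z ω)) = ((∫ ω, (ℓ (Z ω)).toReal ∂P : ℝ) : EReal) := by
  rw [integral_eq_lintegral_pos_part_sub_lintegral_neg_part h.2]
  have h1 : (fun ω => (ℓ (Z ω)).toENNReal) =ᵐ[P] fun ω => ENNReal.ofReal (ℓ (Z ω)).toReal := by
    filter_upwards [h.1] with ω hω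
    rw [EReal.toENNReal_of_ne_top hω]
  have h2 : (fun ω => (-ℓ (Z ω)).toENNReal) =ᵐ[P]
      fun ω => ENNReal.ofReal (-(ℓ (Z ω)).toReal) := by
    filter_upwards [h.1] with ω hω
    rw [EReal.toENNReal_of_ne_top (by simp [hℓ.ne_bot]), EReal.toReal_neg_eq]
  unfold expect
  rw [lintegral_congr_ae h1, lintegral_congr_ae h2, EReal.coe_sub]
  have fin1 : ∫⁻ ω, ENNReal.ofReal (ℓ (Z ω)).toReal ∂P ≠ ⊤ := h.2.lintegral_lt_top.ne
  have fin2 : ∫⁻ ω, ENNReal.ofReal (-(ℓ (Z ω)).toReal) ∂P ≠ ⊤ := h.2.neg.lintegral_lt_top.ne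
  lift ∫⁻ ω, ENNReal.ofReal (ℓ (Z ω)).toReal ∂P to NNReal using fin1 with r
  lift ∫⁻ ω, ENNReal.ofReal (-(ℓ (Z ω)).toReal) ∂P to NNReal using fin2 with s
  rfl

theorem aestronglyMeasurable_toReal (hℓ : IsLossFunction ℓ) {Z : Ω → Fin d → ℝ}
    (hZ : AEMeasurable Z P) : AEStronglyMeasurable (fun ω => (ℓ (Z ω)).toReal) P :=
  (hℓ.measurable_toReal.comp_aemeasurable hZ).aestronglyMeasurable

theorem Integrable.sum_apply {Z : Ω → Fin d → ℝ} (hZ : Integrable Z P) :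
    Integrable (fun ω => ∑ k, Z ω k) P :=
  integrable_finsetSum _ fun k _ => hZ.eval k

/-- The gradient inequality for expected losses. -/
theorem FinExp.gradient_le (hℓ : IsLossFunction ℓ) {Z W : Ω → Fin d → ℝ}
    (hZ : FinExp ℓ P Z) (hW : FinExp ℓ P W) (hdiff : ∀ᵐ ω ∂P, DiffAt ℓ (Z ω))
    (hi : Integrable (fun ω => grad ℓ (Z ω) ⬝ᵥ (W ω - Z ω)) P) :
    ∫ ω, (ℓ (Z ω)).toReal ∂P + ∫ ω, grad ℓ (Z ω) ⬝ᵥ (W ω - Z ω) ∂P ≤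
      ∫ ω, (ℓ (W ω)).toReal ∂P := by
  rw [← integral_add hZ.2 hi]
  refine integral_mono_ae (hZ.2.add hi) hW.2 ?_
  filter_upwards [hdiff, hW.1] with ω h1 h2
  have := hℓ.grad_dotProduct_le (h := W ω - Z ω) h1 one_pos (by simpa using h2)
  simp only [one_smul, add_sub_cancel, div_one] at this
  linarith

/-- The lower bound keeps the negative part integrable, so an infinite positive part would make the
expectation `⊤`. -/
theorem finExp_of_le_of_expect_ne_top (hℓ : IsLossFunction ℓ) {Z : Ω → Fin d → ℝ}
    (hZ : AEMeasurable Z P) {g : Ω → ℝ} (hlow : Integrable g P) (hg : ∀ ω, g ω ≤ ℓ (Z ω))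
    (h : expect P (fun ω => ℓ (Z ω)) ≠ ⊤) : FinExp ℓ P Z := by
  have hneg : ∫⁻ ω, (-ℓ (Z ω)).toENNReal ∂P ≠ ⊤ := by
    refine ne_top_of_le_ne_top hlow.neg.lintegral_lt_top.ne (lintegral_mono fun ω => ?_)
    rw [← EReal.real_coe_toENNReal]
    refine EReal.toENNReal_le_toENNReal ?_
    rw [Pi.neg_apply, EReal.coe_neg]
    exact EReal.neg_le_neg_iff.2 (hg _)
  have hpos : ∫⁻ ω, (ℓ (Z ω)).toENNReal ∂P ≠ ⊤ := by
    intro hp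
    apply h
    unfold expect
    rw [hp]
    lift ∫⁻ ω, (-ℓ (Z ω)).toENNReal ∂P to NNReal using hneg with r
    rfl
  have hm : AEMeasurable (fun ω => (ℓ (Z ω)).toENNReal) P :=
    (measurable_ereal_toENNReal.comp hℓ.lsc.measurable).comp_aemeasurable hZ
  have hfin : ∀ᵐ ω ∂P, ℓ (Z ω) ≠ ⊤ := by
    filter_upwards [ae_lt_top' hm hpos] with ω hω h
    simp [h] at hω
  refine ⟨hfin, ?_⟩
  have hm' := aestronglyMeasurable_toReal hℓ hZ
  refine ⟨hm', ?_⟩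
  rw [hasFiniteIntegral_iff_norm]
  calc ∫⁻ ω, ENNReal.ofReal ‖(ℓ (Z ω)).toReal‖ ∂P
      ≤ ∫⁻ ω, ((ℓ (Z ω)).toENNReal + (-ℓ (Z ω)).toENNReal) ∂P := by
        refine lintegral_mono_ae ?_
        filter_upwards [hfin] with ω hω
        rw [EReal.toENNReal_of_ne_top hω, EReal.toENNReal_of_ne_top (by simp [hℓ.ne_bot]),
          EReal.toReal_neg_eq, Real.norm_eq_abs]
        rcases le_total 0 (ℓ (Z ω)).toReal with h0 | h0
        · rw [abs_of_nonneg h0]; exact le_self_add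
        · rw [abs_of_nonpos h0]; exact le_add_self
    _ = ∫⁻ ω, (ℓ (Z ω)).toENNReal ∂P + ∫⁻ ω, (-ℓ (Z ω)).toENNReal ∂P := lintegral_add_left' hm _
    _ < ⊤ := ENNReal.add_lt_top.2 ⟨hpos.lt_top, hneg.lt_top⟩

variable [IsProbabilityMeasure P]

theorem finExp_of_expect_ne_top (hℓ : IsLossFunction ℓ) {Z : Ω → Fin d → ℝ}
    (hZ : Integrable Z P) (h : expect P (fun ω => ℓ (Z ω)) ≠ ⊤) : FinExp ℓ P Z := by
  obtain ⟨c, hc⟩ := hℓ.risk_averse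
  exact finExp_of_le_of_expect_ne_top hℓ hZ.aemeasurable
    ((Integrable.sum_apply hZ).sub (integrable_const c)) (fun ω => hc (Z ω)) h

/-- Monotonicity bounds `ℓ(Z)` from above, and the affine minorant `∑ Z_k - c` bounds it from below
by an integrable variable. -/
theorem FinExp.of_ae_le (hℓ : IsLossFunction ℓ) {Z W : Ω → Fin d → ℝ} (hW : FinExp ℓ P W)
    (hZ : Integrable Z P) (h : ∀ᵐ ω ∂P, Z ω ≤ W ω) : FinExp ℓ P Z := by
  obtain ⟨c, hc⟩ := hℓ.exists_le_toReal
  have hfin : ∀ᵐ ω ∂P, ℓ (Z ω) ≠ ⊤ := by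
    filter_upwards [hW.1, h] with ω h1 h2 using hℓ.ne_top_of_le h2 h1
  refine ⟨hfin, ?_⟩
  have hlow : Integrable (fun ω => ∑ k, Z ω k - c) P :=
    (Integrable.sum_apply hZ).sub (integrable_const c)
  refine (hW.2.norm.add hlow.norm).mono' (aestronglyMeasurable_toReal hℓ hZ.aemeasurable) ?_
  filter_upwards [hW.1, h, hfin] with ω h1 h2 h3
  have a1 := hℓ.toReal_mono h2 h1
  have a2 := hc _ h3
  exact abs_le_abs_add_abs_of_le_of_le a2 a1

theorem FinExp.convex (hℓ : IsLossFunction ℓ) {Z W : Ω → Fin d → ℝ} (hZ : FinExp ℓ P Z)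
    (hW : FinExp ℓ P W) (iZ : Integrable Z P) (iW : Integrable W P) {a b : ℝ} (ha : 0 ≤ a)
    (hb : 0 ≤ b) (hab : a + b = 1) :
    FinExp ℓ P (fun ω => a • Z ω + b • W ω) ∧
      ∫ ω, (ℓ (a • Z ω + b • W ω)).toReal ∂P ≤
        a * ∫ ω, (ℓ (Z ω)).toReal ∂P + b * ∫ ω, (ℓ (W ω)).toReal ∂P := by
  obtain ⟨c, hc⟩ := hℓ.exists_le_toReal
  have hfin : ∀ᵐ ω ∂P, ℓ (a • Z ω + b • W ω) ≠ ⊤ := by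
    filter_upwards [hZ.1, hW.1] with ω h1 h2 using (hℓ.toReal_convex h1 h2 ha hb hab).1
  have hint : Integrable (fun ω => a • Z ω + b • W ω) P := (iZ.smul a).add (iW.smul b)
  have hlow : Integrable (fun ω => ∑ k, (a • Z ω + b • W ω) k - c) P :=
    (Integrable.sum_apply hint).sub (integrable_const c)
  have hup : Integrable (fun ω => a * (ℓ (Z ω)).toReal + b * (ℓ (W ω)).toReal) P :=
    (hZ.2.const_mul a).add (hW.2.const_mul b)
  have hle : ∀ᵐ ω ∂P, (ℓ (a • Z ω + b • W ω)).toReal ≤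
      a * (ℓ (Z ω)).toReal + b * (ℓ (W ω)).toReal := by
    filter_upwards [hZ.1, hW.1] with ω h1 h2 using (hℓ.toReal_convex h1 h2 ha hb hab).2
  have hi : Integrable (fun ω => (ℓ (a • Z ω + b • W ω)).toReal) P := by
    refine (hup.norm.add hlow.norm).mono' (aestronglyMeasurable_toReal hℓ hint.aemeasurable) ?_
    filter_upwards [hfin, hle] with ω h1 h2
    have a2 := hc _ h1
    exact abs_le_abs_add_abs_of_le_of_le a2 h2
  refine ⟨⟨hfin, hi⟩, ?_⟩
  rw [← integral_const_mul, ← integral_const_mul, ← integral_add (hZ.2.const_mul a)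
    (hW.2.const_mul b)]
  exact integral_mono_ae hi hup hle

/-- The expected loss is directionally differentiable where the loss is almost surely
differentiable. -/
theorem FinExp.tendsto_quotient (hℓ : IsLossFunction ℓ) {Z H : Ω → Fin d → ℝ}
    (hZ : FinExp ℓ P Z) (iZ : Integrable Z P) (iH : Integrable H P)
    (hdiff : ∀ᵐ ω ∂P, DiffAt ℓ (Z ω)) {ε : ℝ} (hε : 0 < ε)
    (hp : FinExp ℓ P fun ω => Z ω + ε • H ω) (hm : FinExp ℓ P fun ω => Z ω - ε • H ω) :
    Integrable (fun ω => grad ℓ (Z ω) ⬝ᵥ H ω) P ∧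
      (∀ t, 0 < t → t ≤ ε → FinExp ℓ P fun ω => Z ω + t • H ω) ∧
      Tendsto (fun t : ℝ =>
        (∫ ω, (ℓ (Z ω + t • H ω)).toReal ∂P - ∫ ω, (ℓ (Z ω)).toReal ∂P) / t) (𝓝[>] 0)
        (𝓝 (∫ ω, grad ℓ (Z ω) ⬝ᵥ H ω ∂P)) := by
  have hmeas : ∀ t : ℝ, AEStronglyMeasurable
      (fun ω => ((ℓ (Z ω + t • H ω)).toReal - (ℓ (Z ω)).toReal) / t) P := fun t =>
    (((aestronglyMeasurable_toReal hℓ (iZ.add (iH.smul t)).aemeasurable).sub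
      hZ.2.aestronglyMeasurable).aemeasurable.div_const t).aestronglyMeasurable
  have hlim : ∀ᵐ ω ∂P, Tendsto
      (fun t : ℝ => ((ℓ (Z ω + t • H ω)).toReal - (ℓ (Z ω)).toReal) / t) (𝓝[>] 0)
      (𝓝 (grad ℓ (Z ω) ⬝ᵥ H ω)) := by
    filter_upwards [hdiff] with ω hω
    exact (hω.tendsto_quotient (H ω)).mono_left
      (nhdsWithin_mono (0 : ℝ) (fun s (hs : 0 < s) => hs.ne'))
  -- Measurability passes from the quotients to their almost sure limit.
  have hgm : AEStronglyMeasurable (fun ω => grad ℓ (Z ω) ⬝ᵥ H ω) P :=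
    aestronglyMeasurable_of_tendsto_ae (𝓝[>] (0 : ℝ)) hmeas hlim
  -- For `0 < t ≤ ε` the slope lies between the backward and the forward slope of step `ε`; the sum
  -- of their absolute values dominates independently of `t`.
  have hbd : Integrable (fun ω => |((ℓ (Z ω + ε • H ω)).toReal - (ℓ (Z ω)).toReal) / ε| +
      |((ℓ (Z ω)).toReal - (ℓ (Z ω - ε • H ω)).toReal) / ε|) P :=
    ((hp.2.sub hZ.2).div_const ε).abs.add ((hZ.2.sub hm.2).div_const ε).abs
  have hfin : ∀ t, 0 < t → t ≤ ε → FinExp ℓ P fun ω => Z ω + t • H ω := by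
    intro t ht hte
    have := (FinExp.convex hℓ hZ hp iZ (iZ.add (iH.smul ε)) (a := 1 - t / ε) (b := t / ε)
      (by rw [sub_nonneg]; exact (div_le_one hε).2 hte) (by positivity) (by ring)).1
    refine this.congr (Eventually.of_forall fun ω => ?_)
    ext i
    simp
    field_simp
    ring
  have hle : ∀ t, 0 < t → t ≤ ε → ∀ᵐ ω ∂P,
      ‖((ℓ (Z ω + t • H ω)).toReal - (ℓ (Z ω)).toReal) / t‖ ≤
      |((ℓ (Z ω + ε • H ω)).toReal - (ℓ (Z ω)).toReal) / ε| +
      |((ℓ (Z ω)).toReal - (ℓ (Z ω - ε • H ω)).toReal) / ε| := by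
    intro t ht hte
    filter_upwards [hdiff, hp.1, hm.1, hZ.1, (hfin t ht hte).1] with ω h1 h2 h3 h4 h5
    have b1 := hℓ.quotient_mono h4 ht hte h2
    have b2 := (hℓ.le_grad_dotProduct h1 hε h3).trans (hℓ.grad_dotProduct_le h1 ht h5)
    exact abs_le_abs_add_abs_of_le_of_le b2 b1
  refine ⟨?_, hfin, ?_⟩
  · refine hbd.mono' hgm ?_
    filter_upwards [hdiff, hp.1, hm.1] with ω h1 h2 h3
    have b1 := hℓ.grad_dotProduct_le h1 hε h2
    have b2 := hℓ.le_grad_dotProduct h1 hε h3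
    exact abs_le_abs_add_abs_of_le_of_le b2 b1
  · have hIoc : Ioc 0 ε ∈ 𝓝[>] (0 : ℝ) := Ioc_mem_nhdsGT hε
    have := tendsto_integral_filter_of_dominated_convergence _ (Eventually.of_forall hmeas)
      (by filter_upwards [hIoc] with t ht using hle t ht.1 ht.2) hbd hlim
    refine this.congr' ?_
    filter_upwards [hIoc] with t ht
    rw [integral_div, integral_sub (hfin t ht.1 ht.2).2 hZ.2]

end FiniteExpectation

/-! ### Recession directions and permutation invariance. -/

section Recession

variable {d : ℕ} {ℓ : (Fin d → ℝ) → EReal}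

/-- The vectors `u` such that `ℓ` does not increase in the direction `-u`. -/
def recessionCone (ℓ : (Fin d → ℝ) → EReal) : AddSubmonoid (Fin d → ℝ) where
  carrier := {u | ∀ (x : Fin d → ℝ) (r : ℝ), 0 ≤ r → ℓ (x - r • u) ≤ ℓ x}
  zero_mem' := fun x r _ => by simp
  add_mem' := fun {u v} hu hv x r hr => by
    rw [smul_add, ← sub_sub]
    exact (hv _ r hr).trans (hu x r hr)

theorem recessionCone_smul {u : Fin d → ℝ} (hu : u ∈ recessionCone ℓ) {a : ℝ} (ha : 0 ≤ a) :
    a • u ∈ recessionCone ℓ := fun x r hr => by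
  rw [smul_smul]
  exact hu x (r * a) (mul_nonneg hr ha)

theorem recessionCone_perm (hperm : PermutationInvariant ℓ) {u : Fin d → ℝ}
    (hu : u ∈ recessionCone ℓ) (σ : Equiv.Perm (Fin d)) :
    (fun k => u (σ k)) ∈ recessionCone ℓ := fun x r hr => by
  have h1 := hu (fun k => x (σ.symm k)) r hr
  have h2 := hperm σ ((fun k => x (σ.symm k)) - r • u)
  have h3 := hperm σ.symm x
  rw [h3, ← h2] at h1
  convert h1 using 2
  ext k
  simp

/-- The sum of all rearrangements of `u` has equal components and total zero, so it vanishes. Thus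
`-u` is the sum of the other rearrangements, all of which lie in the cone. -/
theorem recessionCone_neg (hperm : PermutationInvariant ℓ) {u : Fin d → ℝ}
    (hu : u ∈ recessionCone ℓ) (h0 : ∑ k, u k = 0) : -u ∈ recessionCone ℓ := by
  classical
  have hsum : ∑ σ : Equiv.Perm (Fin d), (fun k => u (σ k)) = 0 := by
    ext i
    have hc : ∀ j, ∑ σ : Equiv.Perm (Fin d), u (σ i) = ∑ σ : Equiv.Perm (Fin d), u (σ j) := by
      intro j
      rw [← Equiv.sum_comp (Equiv.mulRight (Equiv.swap i j)) fun σ : Equiv.Perm (Fin d) => u (σ j)]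
      simp
    have ht : ∑ j, ∑ σ : Equiv.Perm (Fin d), u (σ j) = 0 := by
      rw [Finset.sum_comm]
      exact Finset.sum_eq_zero fun σ _ => by rw [Equiv.sum_comp σ u, h0]
    simp only [← hc, Finset.sum_const, Finset.card_univ, Fintype.card_fin, nsmul_eq_mul,
      mul_eq_zero, Nat.cast_eq_zero] at ht
    rcases ht with hd | ht
    · subst hd
      exact i.elim0
    · simpa using ht
  rw [← Finset.add_sum_erase _ _ (Finset.mem_univ (1 : Equiv.Perm (Fin d)))] at hsum
  have : -u = ∑ σ ∈ Finset.univ.erase (1 : Equiv.Perm (Fin d)), (fun k => u (σ k)) :=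
    neg_eq_of_add_eq_zero_right (by simpa using hsum)
  rw [this]
  exact sum_mem fun σ _ => recessionCone_perm hperm hu σ

/-- A permutation invariant loss function with a nontrivial zero-sum recession direction is a
function of the sum of the components. -/
theorem eq_of_sum_eq_of_mem_recessionCone (hperm : PermutationInvariant ℓ) {u : Fin d → ℝ}
    (hu : u ∈ recessionCone ℓ) (hu0 : u ≠ 0) (h0 : ∑ k, u k = 0) {x y : Fin d → ℝ}
    (hxy : ∑ k, x k = ∑ k, y k) : ℓ x = ℓ y := by
  classical
  obtain ⟨i, j, hij⟩ : ∃ i j, u j < u i := by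
    by_contra! hcon
    obtain ⟨i, hi⟩ := Function.ne_iff.1 hu0
    have hc : ∀ j, u j = u i := fun j => le_antisymm (hcon j i) (hcon i j)
    simp only [hc, Finset.sum_const, Finset.card_univ, Fintype.card_fin, nsmul_eq_mul,
      mul_eq_zero, Nat.cast_eq_zero] at h0
    rcases h0 with hd | h0
    · subst hd
      exact i.elim0
    · exact hi h0
  -- Adding `u` to the transposed copy of `-u` leaves `(u i - u j)(e_i - e_j)`, a positive multiple
  -- of a difference of basis vectors. Permutations then give all such differences, and these span
  -- the zero-sum vectors.
  have hswap := recessionCone_perm hperm (recessionCone_neg hperm hu h0) (Equiv.swap i j)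
  have hne : i ≠ j := by
    rintro rfl
    exact lt_irrefl _ hij
  have h1 : Pi.single i 1 - Pi.single j 1 ∈ recessionCone ℓ := by
    have h2 := recessionCone_smul (add_mem hu hswap) (a := (u i - u j)⁻¹)
      (inv_nonneg.2 (sub_pos.2 hij).le)
    convert h2 using 1
    have h3 : u i - u j ≠ 0 := (sub_pos.2 hij).ne'
    ext k
    by_cases hki : k = i
    · subst hki
      simp [hne, ← sub_eq_add_neg, h3]
    by_cases hkj : k = j
    · subst hkj
      simp only [Pi.sub_apply, Pi.single_apply, if_neg hki, if_true, Pi.smul_apply, Pi.add_apply,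
        Equiv.swap_apply_right, Pi.neg_apply, smul_eq_mul]
      field_simp
      ring
    · simp [hki, hkj, Equiv.swap_apply_of_ne_of_ne]
  have h2 : ∀ a b : Fin d, Pi.single a 1 - Pi.single b 1 ∈ recessionCone ℓ := by
    intro a b
    by_cases hab : a = b
    · subst hab
      simp
    obtain ⟨σ, hσi, hσj⟩ : ∃ σ : Equiv.Perm (Fin d), σ a = i ∧ σ b = j := by
      refine ⟨(Equiv.swap a i).trans (Equiv.swap (Equiv.swap a i b) j), ?_, ?_⟩
      · rw [Equiv.trans_apply, Equiv.swap_apply_left, Equiv.swap_apply_of_ne_of_ne _ hne]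
        intro h
        rw [eq_comm, Equiv.swap_apply_eq_iff, Equiv.swap_apply_right] at h
        exact hab h.symm
      · simp
    have h3 := recessionCone_perm hperm h1 σ
    convert h3 using 1
    ext k
    simp only [Pi.sub_apply, Pi.single_apply, ← hσi, ← hσj, σ.injective.eq_iff]
  have h3 : ∀ w : Fin d → ℝ, ∑ k, w k = 0 → w ∈ recessionCone ℓ := by
    intro w hw
    have h4 : ∀ (r : ℝ) (a b : Fin d), r • (Pi.single a 1 - Pi.single b 1) ∈ recessionCone ℓ := by
      intro r a b
      rcases le_total 0 r with hr | hr
      · exact recessionCone_smul (h2 a b) hr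
      · have := recessionCone_smul (h2 b a) (neg_nonneg.2 hr)
        convert this using 1
        rw [neg_smul, ← smul_neg, neg_sub]
    have h5 : w = ∑ k, w k • (Pi.single k 1 - Pi.single i 1) := by
      simp_rw [smul_sub]
      rw [Finset.sum_sub_distrib, ← Finset.sum_smul, hw, zero_smul, sub_zero]
      exact pi_eq_sum_univ' w
    rw [h5]
    exact sum_mem fun k _ => h4 _ _ _
  have key : ∀ x y : Fin d → ℝ, ∑ k, x k = ∑ k, y k → ℓ y ≤ ℓ x := by
    intro x y hxy
    have := h3 (x - y) (by simp [hxy]) x 1 zero_le_one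
    simpa using this
  exact le_antisymm (key y x hxy.symm) (key x y hxy)

/-- If the set of deterministic allocations with bounded total and acceptable for `z` is
unbounded, then `ℓ` has a nontrivial zero-sum recession direction. -/
theorem exists_mem_recessionCone (hℓ : IsLossFunction ℓ) (z : Fin d → ℝ) (K : ℝ)
    (hK : ¬ Bornology.IsBounded {m : Fin d → ℝ | ℓ (z - m) ≤ 0 ∧ ∑ k, m k ≤ K}) :
    ∃ u ∈ recessionCone ℓ, u ≠ 0 ∧ ∑ k, u k = 0 := by
  rw [isBounded_iff_forall_norm_le] at hK
  push Not at hK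
  choose m hm using fun n : ℕ => hK (n + 1)
  have hpos : ∀ n, 0 < ‖m n‖ := fun n => lt_trans (by positivity) (hm n).2
  have htop : Tendsto (fun n => ‖m n‖) atTop atTop :=
    tendsto_atTop_mono (fun n => (lt_trans (by simp) (hm n).2).le) tendsto_natCast_atTop_atTop
  have hin : ∀ n, ‖m n‖⁻¹ • m n ∈ Metric.sphere (0 : Fin d → ℝ) 1 := fun n => by
    simp [norm_smul, (hpos n).ne']
  -- The direction is a limit of normalized points of the unbounded set.
  obtain ⟨u, hu1, φ, hφ, hlim⟩ := (isCompact_sphere (0 : Fin d → ℝ) 1).tendsto_subseq hin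
  have htop' : Tendsto (fun n => ‖m (φ n)‖⁻¹) atTop (𝓝 0) :=
    (htop.comp hφ.tendsto_atTop).inv_tendsto_atTop
  have hsle : ∑ k, u k ≤ 0 := by
    have h1 : Tendsto (fun n => ∑ k, (‖m (φ n)‖⁻¹ • m (φ n)) k) atTop (𝓝 (∑ k, u k)) :=
      tendsto_finsetSum _ fun k _ => (tendsto_pi_nhds.1 hlim k)
    have h2 : Tendsto (fun n => ‖m (φ n)‖⁻¹ * K) atTop (𝓝 0) := by
      simpa using htop'.mul_const K
    refine le_of_tendsto_of_tendsto' h1 h2 fun n => ?_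
    simp only [Pi.smul_apply, smul_eq_mul, ← Finset.mul_sum]
    exact mul_le_mul_of_nonneg_left (hm _).1.2 (inv_nonneg.2 (norm_nonneg _))
  have hmem : u ∈ recessionCone ℓ := by
    intro x r hr
    by_cases hx : ℓ x = ⊤
    · simp [hx]
    -- `x - r u` is a limit of convex combinations of `x` and `z - m_n` with weight `r/‖m_n‖ → 0` on
    -- the latter. Since `ℓ(z - m_n) ≤ 0`, that term drops out of the convexity bound, and lower
    -- semicontinuity carries the bound to the limit.
    have hlim2 : Tendsto (fun n => (1 - r * ‖m (φ n)‖⁻¹) • x + (r * ‖m (φ n)‖⁻¹) • (z - m (φ n)))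
        atTop (𝓝 (x - r • u)) := by
      have h0 : Tendsto (fun n => r * ‖m (φ n)‖⁻¹) atTop (𝓝 0) := by
        simpa using htop'.const_mul r
      have h1 := (((tendsto_const_nhds (x := (1 : ℝ))).sub h0).smul_const x).add
        ((h0.smul_const z).sub (hlim.const_smul r))
      simp only [sub_zero, one_smul, zero_smul, zero_sub] at h1
      rw [sub_eq_add_neg]
      refine h1.congr fun n => ?_
      simp [smul_sub, smul_smul]
    have hv : ∀ᶠ n in atTop, ℓ ((1 - r * ‖m (φ n)‖⁻¹) • x + (r * ‖m (φ n)‖⁻¹) • (z - m (φ n))) ≤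
        (((1 - r * ‖m (φ n)‖⁻¹) * (ℓ x).toReal : ℝ) : EReal) := by
      have h0 : Tendsto (fun n => r * ‖m (φ n)‖⁻¹) atTop (𝓝 0) := by
        simpa using htop'.const_mul r
      filter_upwards [h0.eventually_le_const one_pos] with n hn
      have hfin : ℓ (z - m (φ n)) ≠ ⊤ :=
        ne_top_of_le_ne_top EReal.zero_ne_top (hm _).1.1
      have hc := hℓ.toReal_convex hx hfin (a := 1 - r * ‖m (φ n)‖⁻¹) (b := r * ‖m (φ n)‖⁻¹)
        (by linarith) (by positivity) (by ring)
      rw [← hℓ.coe_toReal hc.1, EReal.coe_le_coe_iff]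
      have h2 : (ℓ (z - m (φ n))).toReal ≤ 0 := EReal.toReal_nonpos (hm _).1.1
      have h3 : r * ‖m (φ n)‖⁻¹ * (ℓ (z - m (φ n))).toReal ≤ 0 :=
        mul_nonpos_of_nonneg_of_nonpos (by positivity) h2
      linarith [hc.2]
    by_contra! hlt
    rw [← hℓ.coe_toReal hx] at hlt
    obtain ⟨a, ha1, ha2⟩ := EReal.lt_iff_exists_real_btwn.1 hlt
    have h4 := hlim2.eventually (hℓ.lsc _ _ ha2)
    have h5 : Tendsto (fun n => (1 - r * ‖m (φ n)‖⁻¹) * (ℓ x).toReal) atTop (𝓝 (ℓ x).toReal) := by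
      simpa using ((htop'.const_mul r).const_sub 1).mul_const (ℓ x).toReal
    have h6 := h5.eventually_lt_const (EReal.coe_lt_coe_iff.1 ha1)
    obtain ⟨n, h7, h8, h9⟩ := (h4.and (h6.and hv)).exists
    exact absurd (h7.trans_le h9) (not_lt.2 (EReal.coe_le_coe_iff.2 h8.le))
  refine ⟨u, hmem, ?_, le_antisymm hsle ?_⟩
  · rintro rfl
    simp at hu1
  -- Were the total of `u` negative, the lower bound `∑ (x - r u)_k - c` would tend to infinity with
  -- `r`, while `ℓ(x - r u)` stays below `ℓ x < 0`.
  · obtain ⟨x, hx⟩ := hℓ.inf_neg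
    obtain ⟨c, hc⟩ := hℓ.risk_averse
    by_contra! hneg
    obtain ⟨r, hr⟩ := exists_nat_gt (-(∑ k, x k - c) / -∑ k, u k)
    have h1 := (hc (x - (r : ℝ) • u)).trans_lt ((hmem x r (Nat.cast_nonneg r)).trans_lt hx)
    have h2 : ∑ k, (x - (r : ℝ) • u) k - c < 0 := by exact_mod_cast h1
    simp only [Pi.sub_apply, Pi.smul_apply, smul_eq_mul, Finset.sum_sub_distrib,
      ← Finset.mul_sum] at h2
    rw [div_lt_iff₀ (by linarith)] at hr
    nlinarith

end Recession

/-! ### The Orlicz heart, acceptable sets and existence of risk allocations. -/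

section OrliczHeart

variable {d : ℕ} {ℓ : (Fin d → ℝ) → EReal} {Ω : Type*} [MeasurableSpace Ω] {P : Measure Ω}

theorem IsRiskAllocation.of_le {X : Ω → Fin d → ℝ} {m : Fin d → ℝ} (hm : m ∈ acceptable ℓ P X)
    (h : ∀ n ∈ acceptable ℓ P X, ∑ k, m k ≤ ∑ k, n k) : IsRiskAllocation ℓ P X m :=
  ⟨hm, le_antisymm (iInf₂_le m hm) (le_iInf₂ fun n hn => EReal.coe_le_coe_iff.2 (h n hn))⟩

theorem IsRiskAllocation.sum_le {X : Ω → Fin d → ℝ} {m n : Fin d → ℝ}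
    (hm : IsRiskAllocation ℓ P X m) (hn : n ∈ acceptable ℓ P X) : ∑ k, m k ≤ ∑ k, n k := by
  have := iInf₂_le (f := fun m (_ : m ∈ acceptable ℓ P X) => ((∑ k, m k : ℝ) : EReal)) n hn
  rw [← shortfallRisk, hm.2] at this
  exact EReal.coe_le_coe_iff.1 this

theorem finExp_const [IsFiniteMeasure P] {z : Fin d → ℝ} (hz : ℓ z ≠ ⊤) :
    FinExp ℓ P fun _ => z :=
  ⟨Eventually.of_forall fun _ => hz, integrable_const _⟩

theorem Integrable.pi_abs {X : Ω → Fin d → ℝ} (iX : Integrable X P) :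
    Integrable (fun ω => |X ω|) P :=
  Integrable.of_eval fun k => (iX.eval k).abs

variable [IsProbabilityMeasure P]

theorem finExp_abs_of_mem_orliczHeart (hℓ : IsLossFunction ℓ) {X : Ω → Fin d → ℝ}
    (hX : X ∈ orliczHeart ℓ P) {r : ℝ} (hr : 0 ≤ r) : FinExp ℓ P fun ω => |r • X ω| := by
  obtain ⟨c, hc⟩ := hℓ.risk_averse
  have hm : Measurable fun x : Fin d → ℝ => |x| := by
    refine measurable_pi_lambda _ fun k => ?_
    simp only [Pi.abs_apply]
    fun_prop
  refine finExp_of_le_of_expect_ne_top hℓ (hm.comp_aemeasurable (hX.1.const_smul r))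
    (integrable_const (-c)) (fun ω => le_trans ?_ (hc _)) (hX.2 r hr).ne
  rw [EReal.coe_le_coe_iff]
  have : 0 ≤ ∑ k, |r • X ω| k := Finset.sum_nonneg fun k _ => abs_nonneg _
  linarith

/-- Each `|X_k|` is at most `∑ |X_j| ≤ ℓ(|X|) + c`. -/
theorem integrable_of_mem_orliczHeart (hℓ : IsLossFunction ℓ) {X : Ω → Fin d → ℝ}
    (hX : X ∈ orliczHeart ℓ P) : Integrable X P := by
  have h1 := finExp_abs_of_mem_orliczHeart hℓ hX zero_le_one
  simp only [one_smul] at h1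
  obtain ⟨c, hc⟩ := hℓ.exists_le_toReal
  refine Integrable.of_eval fun k => ?_
  refine (h1.2.add (integrable_const c)).mono'
    ((measurable_pi_apply k).comp_aemeasurable hX.1).aestronglyMeasurable ?_
  filter_upwards [h1.1] with ω hω
  have h2 := hc _ hω
  have h3 : |X ω k| ≤ ∑ k, |X ω| k :=
    Finset.single_le_sum (f := fun k => |X ω| k) (fun k _ => abs_nonneg _) (Finset.mem_univ k)
  simp only [Pi.add_apply, Real.norm_eq_abs]
  linarith

theorem expect_const (hℓ : IsLossFunction ℓ) (z : Fin d → ℝ) :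
    expect P (fun _ => ℓ z) = ℓ z := by
  by_cases hz : ℓ z = ⊤
  · simp [expect, hz]
  · rw [expect_eq_integral hℓ (Z := fun _ => z) (finExp_const hz), ← hℓ.coe_toReal hz]
    simp

/-- The vector lies below the convex combination `½|2aX| + ¼|4bY| + ¼(4v)`, and the heart admits
every dilation. -/
theorem finExp_affine (hℓ : IsLossFunction ℓ) (hfin : ∀ x, ℓ x ≠ ⊤) {X Y : Ω → Fin d → ℝ}
    (hX : X ∈ orliczHeart ℓ P) (hY : Y ∈ orliczHeart ℓ P) (a b : ℝ) (v : Fin d → ℝ) :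
    FinExp ℓ P fun ω => a • X ω + b • Y ω + v := by
  have iX := integrable_of_mem_orliczHeart hℓ hX
  have iY := integrable_of_mem_orliczHeart hℓ hY
  have h1 := finExp_abs_of_mem_orliczHeart hℓ hX (r := 2 * |a|) (by positivity)
  have h2 := finExp_abs_of_mem_orliczHeart hℓ hY (r := 4 * |b|) (by positivity)
  have h3 : FinExp ℓ P fun _ => (4 : ℝ) • v := finExp_const (hfin _)
  have h4 := FinExp.convex hℓ h2 h3 (Integrable.pi_abs (iY.smul (4 * |b|))) (integrable_const _)
    (a := 1 / 2) (b := 1 / 2) (by norm_num) (by norm_num) (by norm_num)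
  have h5 := FinExp.convex hℓ h1 h4.1 (Integrable.pi_abs (iX.smul (2 * |a|)))
    (((Integrable.pi_abs (iY.smul (4 * |b|))).smul (1 / 2 : ℝ)).add ((integrable_const _).smul (1 / 2 : ℝ)))
    (a := 1 / 2) (b := 1 / 2) (by norm_num) (by norm_num) (by norm_num)
  refine h5.1.of_ae_le hℓ (((iX.smul a).add (iY.smul b)).add (integrable_const v))
    (Eventually.of_forall fun ω k => ?_)
  simp only [Pi.add_apply, Pi.smul_apply, smul_eq_mul, Pi.abs_apply, abs_mul, abs_abs,
    Nat.abs_ofNat]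
  have e1 := le_abs_self (a * X ω k)
  have e2 := le_abs_self (b * Y ω k)
  rw [abs_mul] at e1 e2
  linarith

/-- Either the loss function is finite, or the Orlicz heart is trivial. -/
theorem forall_ne_top_or_ae_eq_zero (hℓ : IsLossFunction ℓ) (hperm : PermutationInvariant ℓ)
    {X : Ω → Fin d → ℝ} (hX : X ∈ orliczHeart ℓ P) : (∀ x, ℓ x ≠ ⊤) ∨ X =ᵐ[P] 0 := by
  classical
  by_cases hX0 : X =ᵐ[P] 0
  · exact Or.inr hX0
  left
  have h1 : ∀ᵐ ω ∂P, ∀ n : ℕ, ℓ |(n : ℝ) • X ω| ≠ ⊤ :=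
    ae_all_iff.2 fun n => (finExp_abs_of_mem_orliczHeart hℓ hX (Nat.cast_nonneg n)).1
  -- One outcome suffices: `X ω ≠ 0`, and `ℓ` is finite at all integer multiples of `|X ω|`.
  obtain ⟨ω, hω0, hω⟩ := ((not_eventually.1 hX0).and_eventually h1).exists
  obtain ⟨k, hk⟩ := Function.ne_iff.1 hω0
  have hk' : 0 < |X ω k| := abs_pos.2 hk
  have hconv : Convex ℝ {x | ℓ x ≠ ⊤} := fun x hx y hy a b ha hb hab =>
    (hℓ.toReal_convex hx hy ha hb hab).1
  intro x
  obtain ⟨n, hn⟩ := exists_nat_gt (d * ‖x‖ / |X ω k|)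
  rw [div_lt_iff₀ hk'] at hn
  have hd : 0 < d := Fin.pos k
  have hd' : (0 : ℝ) < d := Nat.cast_pos.2 hd
  -- The domain of `ℓ` is closed under passing to smaller vectors, permutations and convex
  -- combinations. The average of the vectors `d‖x‖ e_j` is the constant vector `‖x‖`, which lies
  -- above `x`; this explains the factor `d`.
  have h2 : ∀ j : Fin d, ℓ (Pi.single j (d * ‖x‖)) ≠ ⊤ := by
    intro j
    have h3 : ℓ (Pi.single k (d * ‖x‖)) ≠ ⊤ := by
      refine hℓ.ne_top_of_le (fun i => ?_) (hω n)
      by_cases hik : i = k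
      · subst hik
        simp only [Pi.single_eq_same, Pi.abs_apply, Pi.smul_apply, smul_eq_mul, abs_mul,
          Nat.abs_cast]
        exact hn.le
      · simp [hik]
        positivity
    rw [← hperm (Equiv.swap j k)] at h3
    convert h3 using 2
    ext i
    simp only [Pi.single_apply, Equiv.swap_apply_eq_iff, Equiv.swap_apply_right]
  have h3 := hconv.sum_mem (t := Finset.univ) (w := fun _ : Fin d => (1 / d : ℝ))
    (z := fun j => Pi.single j (d * ‖x‖)) (fun _ _ => by positivity) (by simp [hd'.ne'])
    (fun j _ => h2 j)
  refine hℓ.ne_top_of_le (fun i => ?_) h3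
  simp only [Finset.sum_apply, Pi.smul_apply, Pi.single_apply, smul_eq_mul, mul_ite, mul_zero,
    Finset.sum_ite_eq, Finset.mem_univ, if_true]
  have : (1 / d : ℝ) * (d * ‖x‖) = ‖x‖ := by field_simp
  rw [this]
  exact (le_abs_self _).trans (norm_le_pi_norm x i)

theorem finExp_sub (hℓ : IsLossFunction ℓ) (hfin : ∀ x, ℓ x ≠ ⊤) {X : Ω → Fin d → ℝ}
    (hX : X ∈ orliczHeart ℓ P) (m : Fin d → ℝ) : FinExp ℓ P fun ω => X ω - m := by
  have := finExp_affine hℓ hfin hX hX 1 0 (-m)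
  simpa [sub_eq_add_neg] using this

theorem integrable_sub_const {X : Ω → Fin d → ℝ} (iX : Integrable X P) (m : Fin d → ℝ) :
    Integrable (fun ω => X ω - m) P :=
  iX.sub (integrable_const m)

theorem mem_acceptable_iff (hℓ : IsLossFunction ℓ) {X : Ω → Fin d → ℝ} (iX : Integrable X P)
    (m : Fin d → ℝ) : m ∈ acceptable ℓ P X ↔
      FinExp ℓ P (fun ω => X ω - m) ∧ ∫ ω, (ℓ (X ω - m)).toReal ∂P ≤ 0 := by
  constructor
  · intro h
    have h1 : FinExp ℓ P fun ω => X ω - m :=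
      finExp_of_expect_ne_top hℓ (integrable_sub_const iX m)
        (ne_top_of_le_ne_top EReal.zero_ne_top h)
    refine ⟨h1, ?_⟩
    have h2 : expect P (fun ω => ℓ (X ω - m)) ≤ 0 := h
    rw [expect_eq_integral hℓ h1] at h2
    exact_mod_cast h2
  · rintro ⟨h1, h2⟩
    change expect P (fun ω => ℓ (X ω - m)) ≤ 0
    rw [expect_eq_integral hℓ h1]
    exact_mod_cast h2

theorem mem_acceptable_iff_of_ae_eq_zero (hℓ : IsLossFunction ℓ) {X : Ω → Fin d → ℝ}
    (hX : X =ᵐ[P] 0) (m : Fin d → ℝ) : m ∈ acceptable ℓ P X ↔ ℓ (-m) ≤ 0 := by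
  change expect P (fun ω => ℓ (X ω - m)) ≤ 0 ↔ ℓ (-m) ≤ 0
  have : (fun ω => ℓ (X ω - m)) =ᵐ[P] fun _ => ℓ (-m) := by
    filter_upwards [hX] with ω hω
    simp [hω]
  rw [expect_congr this, expect_const hℓ]

theorem IsLossFunction.convexOn_toReal (hℓ : IsLossFunction ℓ) (hfin : ∀ x, ℓ x ≠ ⊤) :
    ConvexOn ℝ univ fun x => (ℓ x).toReal :=
  ⟨convex_univ, fun x _ y _ _ _ ha hb hab =>
    (hℓ.toReal_convex (hfin x) (hfin y) ha hb hab).2⟩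

/-- If `ℓ` is finite, the expected loss is a finite convex function on `ℝ^d`, hence continuous.
Otherwise `X` vanishes and lower semicontinuity of `ℓ` itself is enough. -/
theorem isClosed_acceptable (hℓ : IsLossFunction ℓ) (hperm : PermutationInvariant ℓ)
    {X : Ω → Fin d → ℝ} (hX : X ∈ orliczHeart ℓ P) : IsClosed (acceptable ℓ P X) := by
  have iX := integrable_of_mem_orliczHeart hℓ hX
  rcases forall_ne_top_or_ae_eq_zero hℓ hperm hX with hfin | h0
  · have hconv : ConvexOn ℝ univ fun m : Fin d → ℝ => ∫ ω, (ℓ (X ω - m)).toReal ∂P := by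
      refine ⟨convex_univ, fun m _ n _ a b ha hb hab => ?_⟩
      have := (FinExp.convex hℓ (finExp_sub hℓ hfin hX m) (finExp_sub hℓ hfin hX n)
        (integrable_sub_const iX m) (integrable_sub_const iX n) ha hb hab).2
      refine le_trans (le_of_eq ?_) this
      refine integral_congr_ae (Eventually.of_forall fun ω => ?_)
      have e : X ω - (a • m + b • n) = a • (X ω - m) + b • (X ω - n) := by
        obtain rfl : a = 1 - b := by linarith
        ext k
        simp
        ring
      simp only [e]
    have hcont := continuousOn_univ.1 (hconv.continuousOn isOpen_univ)
    have : acceptable ℓ P X = {m | ∫ ω, (ℓ (X ω - m)).toReal ∂P ≤ 0} := by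
      ext m
      rw [mem_acceptable_iff hℓ iX]
      exact ⟨fun h => h.2, fun h => ⟨finExp_sub hℓ hfin hX m, h⟩⟩
    rw [this]
    exact isClosed_le hcont continuous_const
  · have : acceptable ℓ P X = (fun m => -m) ⁻¹' (ℓ ⁻¹' Iic 0) := by
      ext m
      rw [mem_acceptable_iff_of_ae_eq_zero hℓ h0]
      rfl
    rw [this]
    exact (hℓ.lsc.isClosed_preimage 0).preimage continuous_neg

/-- Jensen's inequality: acceptable allocations are acceptable for the mean. -/
theorem le_zero_of_mem_acceptable (hℓ : IsLossFunction ℓ) (hperm : PermutationInvariant ℓ)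
    {X : Ω → Fin d → ℝ} (hX : X ∈ orliczHeart ℓ P) {m : Fin d → ℝ}
    (hm : m ∈ acceptable ℓ P X) : ℓ (∫ ω, X ω ∂P - m) ≤ 0 := by
  have iX := integrable_of_mem_orliczHeart hℓ hX
  rcases forall_ne_top_or_ae_eq_zero hℓ hperm hX with hfin | h0
  · obtain ⟨h1, h2⟩ := (mem_acceptable_iff hℓ iX m).1 hm
    have hconv := hℓ.convexOn_toReal hfin
    have h3 := hconv.map_integral_le (hconv.continuousOn isOpen_univ) isClosed_univ
      (Eventually.of_forall fun _ => mem_univ _) (integrable_sub_const iX m) h1.2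
    rw [integral_sub iX (integrable_const m)] at h3
    simp only [integral_const, probReal_univ, one_smul] at h3
    rw [← hℓ.coe_toReal (hfin _)]
    exact_mod_cast h3.trans h2
  · have h1 := (mem_acceptable_iff_of_ae_eq_zero hℓ h0 m).1 hm
    rw [integral_congr_ae h0]
    simpa using h1

/-- The Slater condition. -/
theorem exists_integral_neg (hℓ : IsLossFunction ℓ) (hperm : PermutationInvariant ℓ)
    {X : Ω → Fin d → ℝ} (hX : X ∈ orliczHeart ℓ P) :
    ∃ m, FinExp ℓ P (fun ω => X ω - m) ∧ ∫ ω, (ℓ (X ω - m)).toReal ∂P < 0 := by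
  have iX := integrable_of_mem_orliczHeart hℓ hX
  obtain ⟨x, hx⟩ := hℓ.inf_neg
  have hxt : ℓ x ≠ ⊤ := (hx.trans EReal.zero_lt_top).ne
  have hx' : (ℓ x).toReal < 0 := by
    rw [← hℓ.coe_toReal hxt] at hx
    exact_mod_cast hx
  rcases forall_ne_top_or_ae_eq_zero hℓ hperm hX with hfin | h0
  · have hF := fun n : ℕ => finExp_sub hℓ hfin hX (fun _ => (n : ℝ))
    -- Truncating from below at `ℓ x` gives domination; pointwise `X - n ≤ x` eventually, so the
    -- truncated loss becomes the constant `ℓ x < 0`.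
    have hlim : Tendsto (fun n : ℕ => ∫ ω, max (ℓ (X ω - fun _ => (n : ℝ))).toReal (ℓ x).toReal ∂P)
        atTop (𝓝 (∫ _, (ℓ x).toReal ∂P)) := by
      have h0 := finExp_sub hℓ hfin hX 0
      simp only [sub_zero] at h0
      refine tendsto_integral_of_dominated_convergence
        (fun ω => |max (ℓ (X ω)).toReal (ℓ x).toReal| + |(ℓ x).toReal|)
        (fun n => ((hF n).2.sup (integrable_const _)).aestronglyMeasurable)
        ((h0.2.sup (integrable_const (ℓ x).toReal)).abs.add (integrable_const _))
        (fun n => Eventually.of_forall fun ω => ?_) (Eventually.of_forall fun ω => ?_)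
      · refine abs_le_abs_add_abs_of_le_of_le (le_max_right _ _) (max_le_max_right _ ?_)
        refine hℓ.toReal_mono (fun k => ?_) (hfin _)
        simp
      · refine tendsto_const_nhds.congr' ?_
        obtain ⟨N, hN⟩ := exists_nat_gt (‖X ω‖ + ‖x‖)
        filter_upwards [eventually_ge_atTop N] with n hn
        refine (max_eq_right (hℓ.toReal_mono (fun k => ?_) hxt)).symm
        have h1 := (le_abs_self _).trans (norm_le_pi_norm (X ω) k)
        have h2 := (neg_le_abs _).trans (norm_le_pi_norm x k)
        have h3 : (N : ℝ) ≤ n := Nat.cast_le.2 hn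
        simp only [Pi.sub_apply]
        linarith
    simp only [integral_const, probReal_univ, one_smul] at hlim
    obtain ⟨n, hn⟩ := (hlim.eventually_lt_const hx').exists
    exact ⟨_, hF n, (integral_mono (hF n).2 ((hF n).2.sup (integrable_const _))
      fun ω => le_max_left _ _).trans_lt hn⟩
  · have he : (fun _ => x) =ᵐ[P] fun ω => X ω - -x := by
      filter_upwards [h0] with ω hω
      simp [hω]
    refine ⟨-x, (finExp_const hxt).congr he, ?_⟩
    have h1 : (fun ω => (ℓ (X ω - -x)).toReal) =ᵐ[P] fun _ => (ℓ x).toReal := by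
      filter_upwards [he] with ω hω
      rw [← hω]
    rw [integral_congr_ae h1]
    simpa using hx'

/-- Risk allocations exist for permutation invariant loss functions. -/
theorem exists_isRiskAllocation (hd : 0 < d) (hℓ : IsLossFunction ℓ)
    (hperm : PermutationInvariant ℓ) {X : Ω → Fin d → ℝ} (hX : X ∈ orliczHeart ℓ P) :
    ∃ m, IsRiskAllocation ℓ P X m := by
  have iX := integrable_of_mem_orliczHeart hℓ hX
  have hclosed := isClosed_acceptable hℓ hperm hX
  obtain ⟨m₀, hm₀⟩ : (acceptable ℓ P X).Nonempty := by
    obtain ⟨m, h1, h2⟩ := exists_integral_neg hℓ hperm hX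
    exact ⟨m, (mem_acceptable_iff hℓ iX m).2 ⟨h1, h2.le⟩⟩
  have hsum : Continuous fun m : Fin d → ℝ => ∑ k, m k := by fun_prop
  -- `D` is a closed set of representatives: each acceptable total is attained in `D`, and
  -- minimizing sequences in `D` stay bounded. It is the whole space or, if `ℓ` depends on the sum
  -- only, the diagonal.
  suffices H : ∃ D : Set (Fin d → ℝ), IsClosed D ∧
      Bornology.IsBounded (acceptable ℓ P X ∩ D ∩ {m | ∑ k, m k ≤ ∑ k, m₀ k}) ∧
      ∀ m ∈ acceptable ℓ P X, ∃ n ∈ acceptable ℓ P X ∩ D, ∑ k, n k = ∑ k, m k by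
    obtain ⟨D, hD, hb, hrep⟩ := H
    obtain ⟨n₀, hn₀, hn₀'⟩ := hrep m₀ hm₀
    have hcomp := Metric.isCompact_of_isClosed_isBounded
      ((hclosed.inter hD).inter (isClosed_le hsum continuous_const)) hb
    obtain ⟨m, hm, hmin⟩ := hcomp.exists_isMinOn ⟨n₀, hn₀, hn₀'.le⟩ hsum.continuousOn
    refine ⟨m, IsRiskAllocation.of_le hm.1.1 fun n hn => ?_⟩
    obtain ⟨n', h1, h2⟩ := hrep n hn
    rw [← h2]
    by_cases h3 : ∑ k, n' k ≤ ∑ k, m₀ k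
    · exact hmin ⟨h1, h3⟩
    · exact hm.2.trans (not_le.1 h3).le
  by_cases hb : Bornology.IsBounded
      {m : Fin d → ℝ | ℓ (∫ ω, X ω ∂P - m) ≤ 0 ∧ ∑ k, m k ≤ ∑ k, m₀ k}
  · refine ⟨univ, isClosed_univ, hb.subset ?_, fun m hm => ⟨m, ⟨hm, mem_univ _⟩, rfl⟩⟩
    rintro m ⟨⟨hm, -⟩, h⟩
    exact ⟨le_zero_of_mem_acceptable hℓ hperm hX hm, h⟩
  · obtain ⟨u, hu, hu0, hus⟩ := exists_mem_recessionCone hℓ _ _ hb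
    have heq := fun x y => eq_of_sum_eq_of_mem_recessionCone hperm hu hu0 hus (x := x) (y := y)
    obtain ⟨c, hc⟩ := hℓ.risk_averse
    have hd' : (0 : ℝ) < d := Nat.cast_pos.2 hd
    refine ⟨{m | ∀ i j, m i = m j}, ?_, ?_, ?_⟩
    · simp only [ofPred_forall]
      exact isClosed_iInter fun i => isClosed_iInter fun j =>
        isClosed_eq (continuous_apply i) (continuous_apply j)
    · rw [isBounded_iff_forall_norm_le]
      refine ⟨(|∑ k, m₀ k| + |∑ k, (∫ ω, X ω ∂P) k - c|) / d, ?_⟩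
      rintro m ⟨⟨hm, hmc⟩, hle⟩
      have h1 := (hc _).trans (le_zero_of_mem_acceptable hℓ hperm hX hm)
      have h2 : ∑ k, (∫ ω, X ω ∂P - m) k - c ≤ 0 := by exact_mod_cast h1
      simp only [Pi.sub_apply, Finset.sum_sub_distrib] at h2
      rw [pi_norm_le_iff_of_nonneg (by positivity)]
      intro i
      have h3 : ∑ k, m k = d * m i := by simp [fun k => hmc k i]
      have h4 : ‖m i‖ * d = |∑ k, m k| := by
        rw [h3, abs_mul, abs_of_pos hd', Real.norm_eq_abs, mul_comm]
      rw [le_div_iff₀ hd', h4]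
      exact abs_le_abs_add_abs_of_le_of_le (by linarith) hle
    · intro m hm
      have hs : ∑ k : Fin d, (fun _ => (∑ k, m k) / d) k = ∑ k, m k := by
        simp [mul_div_cancel₀ _ hd'.ne']
      refine ⟨fun _ => (∑ k, m k) / d, ⟨?_, fun _ _ => rfl⟩, hs⟩
      have : ∀ ω, ℓ (X ω - fun _ => (∑ k, m k) / d) = ℓ (X ω - m) := fun ω => heq _ _ (by
        simp only [Pi.sub_apply, Finset.sum_sub_distrib, hs])
      change expect P _ ≤ 0
      simp only [this]
      exact hm

end OrliczHeart

/-! ### Karush-Kuhn-Tucker conditions, saddle points and the marginal risk. -/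

section Regular

variable {d : ℕ} {ℓ : (Fin d → ℝ) → EReal} {Ω : Type*} [MeasurableSpace Ω] {P : Measure Ω}

/-- The expected loss at `X - m` is finite, also after small perturbations of `X - m` along `Y` and
constants, and `ℓ` is almost surely differentiable at `X - m`. -/
structure RegularAt (ℓ : (Fin d → ℝ) → EReal) (P : Measure Ω) (X Y : Ω → Fin d → ℝ)
    (m : Fin d → ℝ) : Prop where
  finExp : FinExp ℓ P fun ω => X ω - m
  diffAt : ∀ᵐ ω ∂P, DiffAt ℓ (X ω - m)
  near : ∀ (s : ℝ) (n : Fin d → ℝ), ∃ ε : ℝ, 0 < ε ∧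
    FinExp ℓ P (fun ω => X ω - m + ε • (s • Y ω - n)) ∧
    FinExp ℓ P (fun ω => X ω - m - ε • (s • Y ω - n))

theorem lagrangian_eq (hℓ : IsLossFunction ℓ) {X : Ω → Fin d → ℝ} {m : Fin d → ℝ}
    (hF : FinExp ℓ P fun ω => X ω - m) (lam : ℝ) : lagrangian ℓ P X m lam =
      ((∑ k, m k + lam * ∫ ω, (ℓ (X ω - m)).toReal ∂P : ℝ) : EReal) := by
  rw [lagrangian, expect_eq_integral hℓ hF]
  norm_cast

variable [IsProbabilityMeasure P]

theorem regularAt_of_forall_ne_top (hℓ : IsLossFunction ℓ) (hfin : ∀ x, ℓ x ≠ ⊤)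
    {X Y : Ω → Fin d → ℝ} (hX : X ∈ orliczHeart ℓ P) (hY : Y ∈ orliczHeart ℓ P) {m : Fin d → ℝ}
    (hm : ∀ᵐ ω ∂P, DiffAt ℓ (X ω - m)) : RegularAt ℓ P X Y m := by
  refine ⟨finExp_sub hℓ hfin hX m, hm, fun s n => ⟨1, one_pos, ?_, ?_⟩⟩
  · refine (finExp_affine hℓ hfin hX hY 1 s (-m - n)).congr (Eventually.of_forall fun ω => ?_)
    module
  · refine (finExp_affine hℓ hfin hX hY 1 (-s) (-m + n)).congr (Eventually.of_forall fun ω => ?_)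
    module

/-- If `ℓ` takes the value `⊤`, then `X` and `Y` both vanish, and finiteness is needed only near the
point `-m`, where differentiability includes it. -/
theorem regularAt_of_orliczHeart (hℓ : IsLossFunction ℓ) (hperm : PermutationInvariant ℓ)
    {X Y : Ω → Fin d → ℝ} (hX : X ∈ orliczHeart ℓ P) (hY : Y ∈ orliczHeart ℓ P) {m : Fin d → ℝ}
    (hm : ∀ᵐ ω ∂P, DiffAt ℓ (X ω - m)) : RegularAt ℓ P X Y m := by
  rcases forall_ne_top_or_ae_eq_zero hℓ hperm hX with hfin | hX0
  · exact regularAt_of_forall_ne_top hℓ hfin hX hY hm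
  rcases forall_ne_top_or_ae_eq_zero hℓ hperm hY with hfin | hY0
  · exact regularAt_of_forall_ne_top hℓ hfin hX hY hm
  obtain ⟨ω, hω, hω0⟩ := (hm.and hX0).exists
  rw [hω0, Pi.zero_apply, zero_sub] at hω
  refine ⟨(finExp_const hω.1.self_of_nhds).congr ?_, hm, fun s n => ?_⟩
  · filter_upwards [hX0] with ω h
    simp [h]
  have h1 : Tendsto (fun ε : ℝ => -m + ε • -n) (𝓝 0) (𝓝 (-m)) := by
    have : Continuous fun ε : ℝ => -m + ε • -n := by fun_prop
    simpa using this.tendsto 0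
  have h2 : Tendsto (fun ε : ℝ => -m - ε • -n) (𝓝 0) (𝓝 (-m)) := by
    have : Continuous fun ε : ℝ => -m - ε • -n := by fun_prop
    simpa using this.tendsto 0
  have h3 := ((h1.eventually hω.1).and (h2.eventually hω.1)).filter_mono
    (nhdsWithin_le_nhds (s := Ioi (0 : ℝ)))
  obtain ⟨ε, ⟨h4, h5⟩, hε⟩ := (h3.and self_mem_nhdsWithin).exists
  refine ⟨ε, hε, (finExp_const h4).congr ?_, (finExp_const h5).congr ?_⟩
  · filter_upwards [hX0, hY0] with ω h h'
    simp [h, h']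
  · filter_upwards [hX0, hY0] with ω h h'
    simp [h, h']

/-- The expected partial derivatives of the loss at `X - m`. -/
noncomputable def meanGrad (ℓ : (Fin d → ℝ) → EReal) (P : Measure Ω) (X : Ω → Fin d → ℝ)
    (m : Fin d → ℝ) (k : Fin d) : ℝ :=
  ∫ ω, grad ℓ (X ω - m) k ∂P

namespace RegularAt

variable {X Y : Ω → Fin d → ℝ} {m : Fin d → ℝ}

theorem integrable_grad_dotProduct (h : RegularAt ℓ P X Y m) (hℓ : IsLossFunction ℓ)
    (iX : Integrable X P) (iY : Integrable Y P) (s : ℝ) (n : Fin d → ℝ) :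
    Integrable (fun ω => grad ℓ (X ω - m) ⬝ᵥ (s • Y ω - n)) P := by
  obtain ⟨ε, hε, h1, h2⟩ := h.near s n
  exact (h.finExp.tendsto_quotient hℓ (integrable_sub_const iX m)
    (integrable_sub_const (iY.smul s) n) h.diffAt hε h1 h2).1

theorem eventually_finExp (h : RegularAt ℓ P X Y m) (hℓ : IsLossFunction ℓ)
    (iX : Integrable X P) (iY : Integrable Y P) (s : ℝ) (n : Fin d → ℝ) :
    ∀ᶠ t in 𝓝[>] (0 : ℝ), FinExp ℓ P fun ω => X ω + (t * s) • Y ω - (m + t • n) := by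
  obtain ⟨ε, hε, h1, h2⟩ := h.near s n
  have h3 := (h.finExp.tendsto_quotient hℓ (integrable_sub_const iX m)
    (integrable_sub_const (iY.smul s) n) h.diffAt hε h1 h2).2.1
  filter_upwards [Ioc_mem_nhdsGT hε] with t ht
  refine (h3 t ht.1 ht.2).congr (Eventually.of_forall fun ω => ?_)
  simp only [Pi.smul_apply]
  module

theorem tendsto_quotient (h : RegularAt ℓ P X Y m) (hℓ : IsLossFunction ℓ)
    (iX : Integrable X P) (iY : Integrable Y P) (s : ℝ) (n : Fin d → ℝ) :
    Tendsto (fun t : ℝ => (∫ ω, (ℓ (X ω + (t * s) • Y ω - (m + t • n))).toReal ∂P -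
        ∫ ω, (ℓ (X ω - m)).toReal ∂P) / t) (𝓝[>] 0)
        (𝓝 (∫ ω, grad ℓ (X ω - m) ⬝ᵥ (s • Y ω - n) ∂P)) := by
  obtain ⟨ε, hε, h1, h2⟩ := h.near s n
  have h3 := (h.finExp.tendsto_quotient hℓ (integrable_sub_const iX m)
    (integrable_sub_const (iY.smul s) n) h.diffAt hε h1 h2).2.2
  have e : ∀ (t : ℝ) ω, X ω - m + t • (s • Y ω - n) = X ω + (t * s) • Y ω - (m + t • n) :=
    fun t ω => by module
  simpa only [Pi.smul_apply, e] using h3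

theorem integrable_grad_apply (h : RegularAt ℓ P X Y m) (hℓ : IsLossFunction ℓ)
    (iX : Integrable X P) (iY : Integrable Y P) (k : Fin d) :
    Integrable (fun ω => grad ℓ (X ω - m) k) P := by
  have := h.integrable_grad_dotProduct hℓ iX iY 0 (-Pi.single k 1)
  simpa using this

theorem integrable_grad_dotProduct_self (h : RegularAt ℓ P X Y m) (hℓ : IsLossFunction ℓ)
    (iX : Integrable X P) (iY : Integrable Y P) :
    Integrable (fun ω => grad ℓ (X ω - m) ⬝ᵥ Y ω) P := by
  simpa using h.integrable_grad_dotProduct hℓ iX iY 1 0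

theorem integral_grad_dotProduct (h : RegularAt ℓ P X Y m) (hℓ : IsLossFunction ℓ)
    (iX : Integrable X P) (iY : Integrable Y P) (s : ℝ) (n : Fin d → ℝ) :
    ∫ ω, grad ℓ (X ω - m) ⬝ᵥ (s • Y ω - n) ∂P =
      s * ∫ ω, grad ℓ (X ω - m) ⬝ᵥ Y ω ∂P - ∑ k, meanGrad ℓ P X m k * n k := by
  have h1 := h.integrable_grad_apply hℓ iX iY
  have h2 := h.integrable_grad_dotProduct_self hℓ iX iY
  have h3 : ∀ ω, grad ℓ (X ω - m) ⬝ᵥ (s • Y ω - n) =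
      s * (grad ℓ (X ω - m) ⬝ᵥ Y ω) - ∑ k, grad ℓ (X ω - m) k * n k := fun ω => by
    rw [dotProduct_sub, dotProduct_smul, smul_eq_mul]
    rfl
  simp_rw [h3]
  rw [integral_sub (h2.const_mul s) (integrable_finsetSum _ fun k _ => (h1 k).mul_const _),
    integral_const_mul, integral_finsetSum _ fun k _ => (h1 k).mul_const _]
  simp_rw [integral_mul_const]
  rfl

theorem gradient_le (h : RegularAt ℓ P X Y m) (hℓ : IsLossFunction ℓ)
    (iX : Integrable X P) (iY : Integrable Y P) {s : ℝ} {n : Fin d → ℝ}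
    (hW : FinExp ℓ P fun ω => X ω + s • Y ω - n) :
    ∫ ω, (ℓ (X ω - m)).toReal ∂P + (s * ∫ ω, grad ℓ (X ω - m) ⬝ᵥ Y ω ∂P -
      ∑ k, meanGrad ℓ P X m k * (n k - m k)) ≤ ∫ ω, (ℓ (X ω + s • Y ω - n)).toReal ∂P := by
  have e : ∀ ω, X ω + s • Y ω - n - (X ω - m) = s • Y ω - (n - m) := fun ω => by abel
  have h1 := FinExp.gradient_le hℓ h.finExp hW h.diffAt
    (by simp only [e]; exact h.integrable_grad_dotProduct hℓ iX iY s (n - m))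
  simp only [e, h.integral_grad_dotProduct hℓ iX iY s (n - m)] at h1
  exact h1

/-- Perturbing an acceptable allocation in a direction which decreases the expected loss. -/
theorem eventually_mem_acceptable (h : RegularAt ℓ P X Y m) (hℓ : IsLossFunction ℓ)
    (iX : Integrable X P) (iY : Integrable Y P) (s : ℝ) (n : Fin d → ℝ)
    (hm : ∫ ω, (ℓ (X ω - m)).toReal ∂P ≤ 0)
    (hn : ∫ ω, (ℓ (X ω - m)).toReal ∂P < 0 ∨
      s * ∫ ω, grad ℓ (X ω - m) ⬝ᵥ Y ω ∂P < ∑ k, meanGrad ℓ P X m k * n k) :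
    ∀ᶠ t in 𝓝[>] (0 : ℝ), m + t • n ∈ acceptable ℓ P (X + (t * s) • Y) := by
  have h1 := h.tendsto_quotient hℓ iX iY s n
  rw [h.integral_grad_dotProduct hℓ iX iY s n] at h1
  have h2 := h.eventually_finExp hℓ iX iY s n
  have h3 : ∀ᶠ t in 𝓝[>] (0 : ℝ),
      ∫ ω, (ℓ (X ω + (t * s) • Y ω - (m + t • n))).toReal ∂P ≤ 0 := by
    rcases hn with hn | hn
    · have h4 := ((tendsto_nhdsWithin_of_tendsto_nhds tendsto_id).mul h1).const_add
        (∫ ω, (ℓ (X ω - m)).toReal ∂P)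
      simp only [id, zero_mul, add_zero] at h4
      filter_upwards [h4.eventually_lt_const hn, self_mem_nhdsWithin] with t ht (ht0 : 0 < t)
      rw [mul_div_cancel₀ _ ht0.ne'] at ht
      linarith
    · filter_upwards [h1.eventually_lt_const (sub_neg.2 hn), self_mem_nhdsWithin]
        with t ht (ht0 : 0 < t)
      rw [div_lt_iff₀ ht0, zero_mul] at ht
      linarith
  filter_upwards [h2, h3] with t h4 h5
  exact (mem_acceptable_iff hℓ (iX.add (iY.smul (t * s))) _).2 ⟨h4, h5⟩

/-- The Karush-Kuhn-Tucker conditions at a risk allocation. -/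
theorem exists_multiplier (h : RegularAt ℓ P X Y m) (hd : 0 < d) (hℓ : IsLossFunction ℓ)
    (iX : Integrable X P) (iY : Integrable Y P) (hm : IsRiskAllocation ℓ P X m)
    (hS : ∃ m', FinExp ℓ P (fun ω => X ω - m') ∧ ∫ ω, (ℓ (X ω - m')).toReal ∂P < 0) :
    ∫ ω, (ℓ (X ω - m)).toReal ∂P = 0 ∧
      ∃ lam : ℝ, 0 < lam ∧ ∀ k, lam * meanGrad ℓ P X m k = 1 := by
  have hle := ((mem_acceptable_iff hℓ iX m).1 hm.1).2
  -- A direction that keeps `m` acceptable for small steps cannot lower the total, by optimality.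
  have hdir : ∀ n : Fin d → ℝ, (∫ ω, (ℓ (X ω - m)).toReal ∂P < 0 ∨
      0 < ∑ k, meanGrad ℓ P X m k * n k) → 0 ≤ ∑ k, n k := by
    intro n hn
    have h1 := h.eventually_mem_acceptable hℓ iX iY 0 n hle (by simpa using hn)
    obtain ⟨t, ht, ht0⟩ := (h1.and self_mem_nhdsWithin).exists
    replace ht0 : 0 < t := ht0
    have h2 := hm.sum_le (n := m + t • n) (by simpa using ht)
    simp only [Pi.add_apply, Pi.smul_apply, smul_eq_mul, Finset.sum_add_distrib,
      ← Finset.mul_sum, le_add_iff_nonneg_right] at h2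
    exact nonneg_of_mul_nonneg_right h2 ht0
  have hzero : ∫ ω, (ℓ (X ω - m)).toReal ∂P = 0 := by
    by_contra hne
    have := hdir (fun _ => -1) (Or.inl (lt_of_le_of_ne hle hne))
    simp at this
    omega
  refine ⟨hzero, ?_⟩
  obtain ⟨m', hF, hneg⟩ := hS
  -- The direction `w` towards the Slater point strictly lowers the expected loss to first order.
  -- Adding `ε w` makes any tangent direction admissible in `hdir`, and then `ε → 0`.
  have h1 := h.gradient_le hℓ iX iY (s := 0) (n := m') (by simpa using hF)
  simp only [zero_smul, add_zero, hzero, zero_mul, zero_add, zero_sub] at h1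
  set w : Fin d → ℝ := m' - m with hw
  set a : ℝ := ∑ k, meanGrad ℓ P X m k * w k with ha
  have hapos : 0 < a := by
    have : a = ∑ k, meanGrad ℓ P X m k * (m' k - m k) := rfl
    linarith
  have hdir' : ∀ n : Fin d → ℝ, ∑ k, meanGrad ℓ P X m k * n k = 0 → 0 ≤ ∑ k, n k := by
    intro n hn
    have h2 : ∀ ε > 0, 0 ≤ ∑ k, n k + ε * ∑ k, w k := by
      intro ε hε
      have h3 := hdir (n + ε • w) (Or.inr (by
        simp only [Pi.add_apply, Pi.smul_apply, smul_eq_mul, mul_add, Finset.sum_add_distrib, hn,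
          zero_add]
        have : ∑ k, meanGrad ℓ P X m k * (ε * w k) = ε * a := by
          rw [ha, Finset.mul_sum]
          exact Finset.sum_congr rfl fun _ _ => by ring
        rw [this]
        positivity))
      simpa [Finset.sum_add_distrib, ← Finset.mul_sum] using h3
    have h3 : Tendsto (fun ε : ℝ => ∑ k, n k + ε * ∑ k, w k) (𝓝[>] 0) (𝓝 (∑ k, n k)) := by
      have : Continuous fun ε : ℝ => ∑ k, n k + ε * ∑ k, w k := by fun_prop
      simpa using (this.tendsto 0).mono_left nhdsWithin_le_nhds
    exact ge_of_tendsto h3 (by filter_upwards [self_mem_nhdsWithin] with ε hε using h2 ε hε)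
  -- Subtracting a multiple of `w` from `e_k` makes it tangent to the constraint. The result and its
  -- negative both have nonnegative total, so the total is zero; this identifies the multiplier `(∑
  -- w_j) / a`.
  have hk : ∀ k, (∑ j, w j) / a * meanGrad ℓ P X m k = 1 := by
    intro k
    have e1 : ∑ j, meanGrad ℓ P X m j *
        ((Pi.single k 1 : Fin d → ℝ) - (meanGrad ℓ P X m k / a) • w) j = 0 := by
      simp only [Pi.sub_apply, Pi.smul_apply, smul_eq_mul, mul_sub, Finset.sum_sub_distrib]
      have : ∑ j, meanGrad ℓ P X m j * (meanGrad ℓ P X m k / a * w j) =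
          meanGrad ℓ P X m k / a * a := by
        rw [ha, Finset.mul_sum]
        exact Finset.sum_congr rfl fun _ _ => by ring
      rw [this, div_mul_cancel₀ _ hapos.ne']
      simp [Pi.single_apply]
    have e2 := hdir' _ e1
    have e3 := hdir' (-((Pi.single k 1 : Fin d → ℝ) - (meanGrad ℓ P X m k / a) • w))
      (by simp only [Pi.neg_apply, mul_neg, Finset.sum_neg_distrib, e1, neg_zero])
    simp only [Pi.neg_apply, Pi.sub_apply, Pi.smul_apply, smul_eq_mul, Finset.sum_neg_distrib,
      Finset.sum_sub_distrib, ← Finset.mul_sum, Finset.sum_pi_single', Finset.mem_univ,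
      if_true] at e2 e3
    have e4 : (∑ j, w j) / a * meanGrad ℓ P X m k = meanGrad ℓ P X m k / a * ∑ j, w j := by
      ring
    linarith
  refine ⟨(∑ j, w j) / a, lt_of_le_of_ne
    (div_nonneg (hdir w (Or.inr hapos)) hapos.le) fun h0 => ?_, hk⟩
  have := hk ⟨0, hd⟩
  rw [← h0, zero_mul] at this
  exact zero_ne_one this

end RegularAt

theorem lagrangian_eq_top (hℓ : IsLossFunction ℓ) {X : Ω → Fin d → ℝ} (iX : Integrable X P)
    {m : Fin d → ℝ} (hF : ¬ FinExp ℓ P fun ω => X ω - m) {lam : ℝ} (hlam : 0 < lam) :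
    lagrangian ℓ P X m lam = ⊤ := by
  have : expect P (fun ω => ℓ (X ω - m)) = ⊤ := by
    by_contra hne
    exact hF (finExp_of_expect_ne_top hℓ (integrable_sub_const iX m) hne)
  rw [lagrangian, this, EReal.coe_mul_top_of_pos hlam]
  rfl

/-- The components in `B(X)` are risk allocations at which the constraint is binding. -/
theorem isRiskAllocation_of_mem_saddleSet (hℓ : IsLossFunction ℓ) {X : Ω → Fin d → ℝ}
    (iX : Integrable X P) (hS : ∃ m', FinExp ℓ P (fun ω => X ω - m')) {m : Fin d → ℝ} {lam : ℝ}
    (h : (m, lam) ∈ saddleSet ℓ P X) :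
    IsRiskAllocation ℓ P X m ∧ FinExp ℓ P (fun ω => X ω - m) ∧
      ∫ ω, (ℓ (X ω - m)).toReal ∂P = 0 := by
  obtain ⟨hlam, hmax, hmin⟩ := h
  simp only at hlam hmax hmin
  have hF : FinExp ℓ P (fun ω => X ω - m) := by
    obtain ⟨m', hm'⟩ := hS
    by_contra hF
    have := hmin m'
    rw [lagrangian_eq_top hℓ iX hF hlam, lagrangian_eq hℓ hm', top_le_iff] at this
    exact EReal.coe_ne_top _ this
  have hmax' : ∀ l : ℝ, 0 < l → l * ∫ ω, (ℓ (X ω - m)).toReal ∂P ≤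
      lam * ∫ ω, (ℓ (X ω - m)).toReal ∂P := by
    intro l hl
    have := hmax l hl
    rw [lagrangian_eq hℓ hF, lagrangian_eq hℓ hF, EReal.coe_le_coe_iff] at this
    linarith
  have h0 : ∫ ω, (ℓ (X ω - m)).toReal ∂P = 0 := by
    -- Halving and doubling the multiplier force both signs of the expected loss.
    have h1 := hmax' (lam / 2) (by positivity)
    have h2 := hmax' (2 * lam) (by positivity)
    nlinarith
  refine ⟨IsRiskAllocation.of_le ((mem_acceptable_iff hℓ iX m).2 ⟨hF, h0.le⟩) fun n hn => ?_,
    hF, h0⟩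
  obtain ⟨hFn, hn0⟩ := (mem_acceptable_iff hℓ iX n).1 hn
  have := hmin n
  rw [lagrangian_eq hℓ hF, lagrangian_eq hℓ hFn, EReal.coe_le_coe_iff, h0] at this
  nlinarith

/-- A risk allocation forms a saddle point with the multiplier of any saddle point. -/
theorem IsRiskAllocation.mem_saddleSet (hℓ : IsLossFunction ℓ) {X : Ω → Fin d → ℝ}
    (iX : Integrable X P) (hS : ∃ m', FinExp ℓ P (fun ω => X ω - m')) {m n : Fin d → ℝ} {lam : ℝ}
    (h : (m, lam) ∈ saddleSet ℓ P X) (hn : IsRiskAllocation ℓ P X n) :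
    (n, lam) ∈ saddleSet ℓ P X := by
  obtain ⟨hm, hF, h0⟩ := isRiskAllocation_of_mem_saddleSet hℓ iX hS h
  obtain ⟨hFn, hn0⟩ := (mem_acceptable_iff hℓ iX n).1 hn.1
  obtain ⟨hlam, hmax, hmin⟩ := h
  simp only at hlam hmax hmin
  have hle := hn.sum_le hm.1
  have h1 := hmin n
  rw [lagrangian_eq hℓ hF, lagrangian_eq hℓ hFn, EReal.coe_le_coe_iff, h0] at h1
  -- Slack at `n` would put the Lagrangian there strictly below its minimum, since the total of `n`
  -- is no larger than that of `m`.
  have h2 : ∫ ω, (ℓ (X ω - n)).toReal ∂P = 0 := by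
    refine le_antisymm hn0 ?_
    by_contra! hlt
    nlinarith
  refine ⟨hlam, fun l hl => ?_, fun m' => le_trans ?_ (hmin m')⟩
  · simp only
    rw [lagrangian_eq hℓ hFn, lagrangian_eq hℓ hFn, h2]
    simp
  · simp only
    rw [lagrangian_eq hℓ hF, lagrangian_eq hℓ hFn, EReal.coe_le_coe_iff, h0, h2]
    linarith

namespace RegularAt

variable {X Y : Ω → Fin d → ℝ} {m : Fin d → ℝ}

/-- The first order conditions are sufficient for saddle points. -/
theorem mem_saddleSet (h : RegularAt ℓ P X Y m) (hℓ : IsLossFunction ℓ) (iX : Integrable X P)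
    (iY : Integrable Y P) {lam : ℝ} (hlam : 0 < lam) (h0 : ∫ ω, (ℓ (X ω - m)).toReal ∂P = 0)
    (hk : ∀ k, lam * meanGrad ℓ P X m k = 1) : (m, lam) ∈ saddleSet ℓ P X := by
  refine ⟨hlam, fun l hl => ?_, fun n => ?_⟩
  · simp only
    rw [lagrangian_eq hℓ h.finExp, lagrangian_eq hℓ h.finExp, h0]
    simp
  · simp only
    by_cases hF : FinExp ℓ P fun ω => X ω - n
    · rw [lagrangian_eq hℓ h.finExp, lagrangian_eq hℓ hF, EReal.coe_le_coe_iff]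
      have h1 := h.gradient_le hℓ iX iY (s := 0) (n := n) (by simpa using hF)
      simp only [zero_smul, add_zero, zero_mul, zero_sub] at h1
      have h2 := mul_le_mul_of_nonneg_left h1 hlam.le
      rw [mul_add, mul_neg, Finset.mul_sum] at h2
      simp only [← mul_assoc, hk, one_mul, Finset.sum_sub_distrib] at h2
      linarith
    · rw [lagrangian_eq_top hℓ iX hF hlam]
      exact le_top

/-- The first order conditions are necessary for saddle points. -/
theorem mul_meanGrad_eq_one (h : RegularAt ℓ P X Y m) (hℓ : IsLossFunction ℓ)
    (iX : Integrable X P) (iY : Integrable Y P) {lam : ℝ} (hs : (m, lam) ∈ saddleSet ℓ P X)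
    (k : Fin d) : lam * meanGrad ℓ P X m k = 1 := by
  obtain ⟨hlam, -, hmin⟩ := hs
  simp only at hlam hmin
  -- The one-sided derivative of the Lagrangian at its minimum is nonnegative in every direction;
  -- `e_k` and `-e_k` together give equality.
  have key : ∀ n : Fin d → ℝ, 0 ≤ ∑ k, n k - lam * ∑ k, meanGrad ℓ P X m k * n k := by
    intro n
    have h1 := ((h.tendsto_quotient hℓ iX iY 0 n).const_mul lam).const_add (∑ k, n k)
    rw [h.integral_grad_dotProduct hℓ iX iY 0 n, zero_mul, zero_sub, mul_neg,
      ← sub_eq_add_neg] at h1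
    refine ge_of_tendsto h1 ?_
    filter_upwards [h.eventually_finExp hℓ iX iY 0 n, self_mem_nhdsWithin] with t ht (ht0 : 0 < t)
    simp only [mul_zero, zero_smul, add_zero] at ht ⊢
    have h2 := hmin (m + t • n)
    rw [lagrangian_eq hℓ h.finExp, lagrangian_eq hℓ ht, EReal.coe_le_coe_iff] at h2
    simp only [Pi.add_apply, Pi.smul_apply, smul_eq_mul, Finset.sum_add_distrib,
      ← Finset.mul_sum] at h2
    rw [mul_div_assoc', ← mul_le_mul_iff_of_pos_left ht0, mul_zero, mul_add,
      mul_div_cancel₀ _ ht0.ne']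
    linarith
  have h1 := key (Pi.single k 1)
  have h2 := key (-Pi.single k 1)
  simp [Pi.single_apply] at h1 h2
  linarith

/-- The marginal risk contribution at a saddle point. -/
theorem marginalRisk_eq (h : RegularAt ℓ P X Y m) (hd : 0 < d) (hℓ : IsLossFunction ℓ)
    (iX : Integrable X P) (iY : Integrable Y P) {lam : ℝ} (hlam : 0 < lam)
    (hm : IsRiskAllocation ℓ P X m) (h0 : ∫ ω, (ℓ (X ω - m)).toReal ∂P = 0)
    (hk : ∀ k, lam * meanGrad ℓ P X m k = 1) :
    marginalRisk ℓ P X Y = (gradTerm ℓ P X Y m lam : EReal) := by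
  set q : ℝ := gradTerm ℓ P X Y m lam with hq
  have hd' : (0 : ℝ) < d := Nat.cast_pos.2 hd
  -- Weak duality: the gradient inequality at any `n` acceptable for `X + tY`, multiplied by `λ`,
  -- has coefficient `1` on each `n_k - m_k`.
  have hlow : ∀ t : ℝ, ((∑ k, m k + t * q : ℝ) : EReal) ≤ shortfallRisk ℓ P (X + t • Y) := by
    intro t
    refine le_iInf₂ fun n hn => ?_
    obtain ⟨hF, hn0⟩ := (mem_acceptable_iff hℓ (iX.add (iY.smul t)) n).1 hn
    have h1 := (h.gradient_le hℓ iX iY hF).trans hn0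
    have h2 := mul_le_mul_of_nonneg_left h1 hlam.le
    rw [h0, zero_add, mul_sub, Finset.mul_sum] at h2
    simp only [← mul_assoc, hk, one_mul, Finset.sum_sub_distrib] at h2
    rw [EReal.coe_le_coe_iff, hq, gradTerm]
    linarith
  -- All `E[∂_k ℓ]` equal `1/λ`, so only the total of a direction matters; total `q + ε` strictly
  -- compensates the first order effect of `Y`.
  have hup : ∀ ε > 0, ∀ᶠ t in 𝓝[>] (0 : ℝ),
      shortfallRisk ℓ P (X + t • Y) ≤ ((∑ k, m k + t * (q + ε) : ℝ) : EReal) := by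
    intro ε hε
    have h1 := h.eventually_mem_acceptable hℓ iX iY 1 (fun _ => (q + ε) / d) h0.le (Or.inr (by
      have e : ∀ k, meanGrad ℓ P X m k = 1 / lam := fun k => by
        rw [eq_div_iff hlam.ne', mul_comm, hk]
      have e' : ∑ k : Fin d, meanGrad ℓ P X m k * ((q + ε) / d) = (q + ε) / lam := by
        simp only [e, Finset.sum_const, Finset.card_univ, Fintype.card_fin, nsmul_eq_mul]
        field_simp
      rw [e', lt_div_iff₀ hlam, hq, gradTerm]
      linarith))
    filter_upwards [h1] with t ht
    rw [mul_one] at ht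
    refine (iInf₂_le _ ht).trans (EReal.coe_le_coe_iff.2 (le_of_eq ?_))
    simp only [Pi.add_apply, Pi.smul_apply, smul_eq_mul, Finset.sum_add_distrib,
      Finset.sum_const, Finset.card_univ, Fintype.card_fin, nsmul_eq_mul]
    field_simp
  have hreal : ∀ᶠ t in 𝓝[>] (0 : ℝ), shortfallRisk ℓ P (X + t • Y) =
      ((shortfallRisk ℓ P (X + t • Y)).toReal : EReal) := by
    filter_upwards [hup 1 one_pos] with t ht
    exact (EReal.coe_toReal (ne_top_of_le_ne_top (EReal.coe_ne_top _) ht)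
      (ne_bot_of_le_ne_bot (EReal.coe_ne_bot _) (hlow t))).symm
  have hlim : Tendsto (fun t : ℝ => ((shortfallRisk ℓ P (X + t • Y)).toReal - ∑ k, m k) / t)
      (𝓝[>] 0) (𝓝 q) := by
    rw [tendsto_order]
    constructor
    · intro a ha
      filter_upwards [hreal, self_mem_nhdsWithin] with t ht (ht0 : 0 < t)
      have h1 := hlow t
      rw [ht, EReal.coe_le_coe_iff] at h1
      rw [lt_div_iff₀ ht0]
      nlinarith
    · intro b hb
      filter_upwards [hreal, hup ((b - q) / 2) (by linarith), self_mem_nhdsWithin]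
        with t ht h1 (ht0 : 0 < t)
      rw [ht, EReal.coe_le_coe_iff] at h1
      rw [div_lt_iff₀ ht0]
      nlinarith
  refine Tendsto.limsup_eq (((continuous_coe_real_ereal.tendsto q).comp hlim).congr' ?_)
  filter_upwards [hreal] with t ht
  rw [ht, hm.2, Function.comp_apply]
  norm_cast

end RegularAt

/-- The formula for the marginal risk contribution. -/
theorem marginalRisk_formula (hd : 0 < d) (hℓ : IsLossFunction ℓ)
    (hperm : PermutationInvariant ℓ) {X Y : Ω → Fin d → ℝ} (hX : X ∈ orliczHeart ℓ P)
    (hY : Y ∈ orliczHeart ℓ P)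
    (hdiff : ∀ m, IsRiskAllocation ℓ P X m → ∀ᵐ ω ∂P, DiffAt ℓ (X ω - m)) :
    (∀ m ∈ saddleB ℓ P X, Integrable (fun ω => grad ℓ (X ω - m) ⬝ᵥ Y ω) P) ∧
      (∀ m ∈ saddleB ℓ P X, IsGreatest (gradTerm ℓ P X Y m '' saddleC ℓ P X)
        (marginalRisk ℓ P X Y).toReal) ∧
      (saddleB ℓ P X).Nonempty ∧
      marginalRisk ℓ P X Y = ((marginalRisk ℓ P X Y).toReal : EReal) := by
  have iX := integrable_of_mem_orliczHeart hℓ hX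
  have iY := integrable_of_mem_orliczHeart hℓ hY
  obtain ⟨m', hF', hneg⟩ := exists_integral_neg hℓ hperm hX
  have hreg : ∀ p ∈ saddleSet ℓ P X, RegularAt ℓ P X Y p.1 ∧
      marginalRisk ℓ P X Y = (gradTerm ℓ P X Y p.1 p.2 : EReal) := by
    intro p hp
    obtain ⟨h1, h2, h3⟩ := isRiskAllocation_of_mem_saddleSet hℓ iX ⟨m', hF'⟩ hp
    have h4 := regularAt_of_orliczHeart hℓ hperm hX hY (hdiff _ h1)
    exact ⟨h4, h4.marginalRisk_eq hd hℓ iX iY hp.1 h1 h3 (h4.mul_meanGrad_eq_one hℓ iX iY hp)⟩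
  obtain ⟨m, hm⟩ := exists_isRiskAllocation hd hℓ hperm hX
  have hr := regularAt_of_orliczHeart hℓ hperm hX hY (hdiff m hm)
  obtain ⟨h0, lam, hlam, hk⟩ := hr.exists_multiplier hd hℓ iX iY hm ⟨m', hF', hneg⟩
  have hs := hr.mem_saddleSet hℓ iX iY hlam h0 hk
  refine ⟨?_, ?_, ⟨m, _, hs, rfl⟩, ?_⟩
  · rintro _ ⟨p, hp, rfl⟩
    exact (hreg p hp).1.integrable_grad_dotProduct_self hℓ iX iY
  · intro n hn
    -- By the product structure every pair is a saddle point, and each has the same gradient term.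
    have key : ∀ l ∈ saddleC ℓ P X,
        gradTerm ℓ P X Y n l = (marginalRisk ℓ P X Y).toReal := by
      intro l hl
      have hp : (n, l) ∈ saddleSet ℓ P X := by
        rw [saddleSet_eq_prod]
        exact ⟨hn, hl⟩
      rw [(hreg _ hp).2, EReal.toReal_coe]
    refine ⟨⟨lam, ⟨_, hs, rfl⟩, key _ ⟨_, hs, rfl⟩⟩, ?_⟩
    rintro _ ⟨l, hl, rfl⟩
    exact (key l hl).le
  · rw [(hreg _ hs).2, EReal.toReal_coe]

end Regular

/-! ### Differentiation under the integral sign. -/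

section ParametricIntegral

variable {d : ℕ} {Ω : Type*} [MeasurableSpace Ω] {P : Measure Ω}

/-- The linear map `(n, s) ↦ s y - n`. -/
noncomputable def shiftMap (y : Fin d → ℝ) : (Fin d → ℝ) × ℝ →L[ℝ] (Fin d → ℝ) :=
  (ContinuousLinearMap.snd ℝ (Fin d → ℝ) ℝ).smulRight y -
    ContinuousLinearMap.fst ℝ (Fin d → ℝ) ℝ

theorem shiftMap_apply (y : Fin d → ℝ) (v : (Fin d → ℝ) × ℝ) :
    shiftMap y v = v.2 • y - v.1 := rfl

theorem continuous_shiftMap : Continuous (shiftMap (d := d)) := by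
  have h : Continuous fun y : Fin d → ℝ =>
      ContinuousLinearMap.smulRightL ℝ ((Fin d → ℝ) × ℝ) (Fin d → ℝ)
        (ContinuousLinearMap.snd ℝ (Fin d → ℝ) ℝ) y := ContinuousLinearMap.continuous _
  exact h.sub continuous_const

theorem hasFDerivAt_comp_shift {φ : (Fin d → ℝ) → ℝ} (hφ : ContDiff ℝ 1 φ) (a y : Fin d → ℝ)
    (x : (Fin d → ℝ) × ℝ) :
    HasFDerivAt (fun x : (Fin d → ℝ) × ℝ => φ (a + x.2 • y - x.1))
      ((fderiv ℝ φ (a + x.2 • y - x.1)).comp (shiftMap y)) x := by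
  have h1 : HasFDerivAt (fun x : (Fin d → ℝ) × ℝ => a + x.2 • y - x.1) (shiftMap y) x := by
    have : (fun x : (Fin d → ℝ) × ℝ => a + x.2 • y - x.1) = fun x => a + shiftMap y x := by
      ext1 x
      rw [shiftMap_apply]
      abel
    rw [this]
    exact (shiftMap y).hasFDerivAt.const_add a
  exact ((hφ.differentiable one_ne_zero).differentiableAt.hasFDerivAt).comp x h1

/-- Differentiation under the integral sign along affine perturbations. -/
theorem contDiffAt_integral_shift {φ : (Fin d → ℝ) → ℝ} (hφ : ContDiff ℝ 1 φ)
    {X Y : Ω → Fin d → ℝ} (hX : AEMeasurable X P) (hY : AEMeasurable Y P)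
    (x₀ : (Fin d → ℝ) × ℝ) {δ : ℝ} (hδ : 0 < δ) {g : Ω → ℝ} (hg : Integrable g P)
    (hint : ∀ x ∈ Metric.ball x₀ δ, Integrable (fun ω => φ (X ω + x.2 • Y ω - x.1)) P)
    (hbound : ∀ᵐ ω ∂P, ∀ x ∈ Metric.ball x₀ δ, ∀ v : (Fin d → ℝ) × ℝ,
      |fderiv ℝ φ (X ω + x.2 • Y ω - x.1) (v.2 • Y ω - v.1)| ≤ g ω * ‖v‖) :
    ContDiffAt ℝ 1 (fun x : (Fin d → ℝ) × ℝ => ∫ ω, φ (X ω + x.2 • Y ω - x.1) ∂P) x₀ ∧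
      ∃ L : (Fin d → ℝ) × ℝ →L[ℝ] ℝ,
        HasFDerivAt (fun x : (Fin d → ℝ) × ℝ => ∫ ω, φ (X ω + x.2 • Y ω - x.1) ∂P) L x₀ ∧
        ∀ v, L v = ∫ ω, fderiv ℝ φ (X ω + x₀.2 • Y ω - x₀.1) (v.2 • Y ω - v.1) ∂P := by
  have hZ : ∀ x : (Fin d → ℝ) × ℝ, AEMeasurable (fun ω => X ω + x.2 • Y ω - x.1) P := fun x =>
    (hX.add (hY.const_smul x.2)).sub_const x.1
  have hD : Continuous (fderiv ℝ φ) := hφ.continuous_fderiv one_ne_zero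
  set F' : (Fin d → ℝ) × ℝ → Ω → (Fin d → ℝ) × ℝ →L[ℝ] ℝ := fun x ω =>
    (fderiv ℝ φ (X ω + x.2 • Y ω - x.1)).comp (shiftMap (Y ω)) with hF'
  have hmeas : ∀ x, AEStronglyMeasurable (F' x) P := fun x => by
    have h1 : AEStronglyMeasurable (fun ω => fderiv ℝ φ (X ω + x.2 • Y ω - x.1)) P :=
      hD.comp_aestronglyMeasurable (hZ x).aestronglyMeasurable
    have h2 : AEStronglyMeasurable (fun ω => shiftMap (Y ω)) P :=
      continuous_shiftMap.comp_aestronglyMeasurable hY.aestronglyMeasurable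
    have hc : Continuous fun p : ((Fin d → ℝ) →L[ℝ] ℝ) × ((Fin d → ℝ) × ℝ →L[ℝ] (Fin d → ℝ)) =>
        p.1.comp p.2 := by fun_prop
    exact hc.comp_aestronglyMeasurable (h1.prodMk h2)
  -- The operator norm bound needs a nonnegative constant, hence `|g|`.
  have hb : ∀ᵐ ω ∂P, ∀ x ∈ Metric.ball x₀ δ, ‖F' x ω‖ ≤ |g ω| := by
    filter_upwards [hbound] with ω hω x hx
    refine ContinuousLinearMap.opNorm_le_bound _ (abs_nonneg _) fun v => ?_
    exact (hω x hx v).trans (mul_le_mul_of_nonneg_right (le_abs_self _) (norm_nonneg _))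
  have hderiv : ∀ x ∈ Metric.ball x₀ δ, HasFDerivAt
      (fun x : (Fin d → ℝ) × ℝ => ∫ ω, φ (X ω + x.2 • Y ω - x.1) ∂P) (∫ ω, F' x ω ∂P) x := by
    intro x hx
    refine hasFDerivAt_integral_of_dominated_of_fderiv_le (Metric.isOpen_ball.mem_nhds hx)
      (Eventually.of_forall fun x => hφ.continuous.comp_aestronglyMeasurable
        (hZ x).aestronglyMeasurable) (hint x hx) (hmeas x) hb hg.abs
      (Eventually.of_forall fun ω x _ => hasFDerivAt_comp_shift hφ _ _ x)
  refine ⟨contDiffAt_one_iff.2 ⟨fun x => ∫ ω, F' x ω ∂P, Metric.ball x₀ δ,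
    Metric.ball_mem_nhds _ hδ, ?_, hderiv⟩, _, hderiv x₀ (Metric.mem_ball_self hδ), fun v => ?_⟩
  · refine continuousOn_of_dominated (fun x _ => hmeas x)
      (fun x hx => hb.mono fun ω hω => hω x hx) hg.abs (Eventually.of_forall fun ω => ?_)
    refine Continuous.continuousOn ?_
    have hc : Continuous fun x : (Fin d → ℝ) × ℝ => fderiv ℝ φ (X ω + x.2 • Y ω - x.1) :=
      hD.comp (by fun_prop)
    exact hc.clm_comp continuous_const
  · have hi : Integrable (F' x₀) P := hg.abs.mono' (hmeas x₀)
      (hb.mono fun ω hω => hω x₀ (Metric.mem_ball_self hδ))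
    rw [ContinuousLinearMap.integral_apply hi]
    rfl

end ParametricIntegral

/-! ### Smooth losses: regularity of the expected loss and gradient. -/

section Smooth

variable {d : ℕ} {ℓ : (Fin d → ℝ) → EReal} {Ω : Type*} [MeasurableSpace Ω] {P : Measure Ω}

theorem IsC2.diffAt (h : IsC2 ℓ) (x : Fin d → ℝ) : DiffAt ℓ x :=
  ⟨Eventually.of_forall h.1, (h.2.differentiable two_ne_zero).differentiableAt⟩

theorem IsC2.contDiff_grad (h : IsC2 ℓ) (k : Fin d) : ContDiff ℝ 1 fun x => grad ℓ x k := by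
  have h1 : ContDiff ℝ 1 (fderiv ℝ fun y => (ℓ y).toReal) :=
    h.2.fderiv_right (by norm_num)
  exact h1.clm_apply contDiff_const

theorem fderiv_grad (ℓ : (Fin d → ℝ) → EReal) (x v : Fin d → ℝ) (j : Fin d) :
    fderiv ℝ (fun y => grad ℓ y j) x v = ∑ i, hess ℓ x i j * v i := by
  conv_lhs => rw [pi_eq_sum_univ' v]
  simp only [hess, Matrix.of_apply, map_sum, map_smul, smul_eq_mul, mul_comm]

theorem IsC2.hess_symm (h : IsC2 ℓ) (x : Fin d → ℝ) (i j : Fin d) :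
    hess ℓ x i j = hess ℓ x j i := by
  have hs : IsSymmSndFDerivAt ℝ (fun y => (ℓ y).toReal) x :=
    h.2.contDiffAt.isSymmSndFDerivAt (by simp)
  have hd : DifferentiableAt ℝ (fderiv ℝ fun y => (ℓ y).toReal) x :=
    ((h.2.fderiv_right (m := 1) (by norm_num)).differentiable one_ne_zero).differentiableAt
  have e : ∀ i j, hess ℓ x i j =
      fderiv ℝ (fderiv ℝ fun y => (ℓ y).toReal) x (Pi.single i 1) (Pi.single j 1) := by
    intro i j
    simp only [hess, Matrix.of_apply, grad]
    rw [fderiv_clm_apply hd (differentiableAt_const _)]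
    simp
  rw [e, e]
  exact hs _ _

theorem IsC2.fderiv_grad_eq_mulVec (h : IsC2 ℓ) (x v : Fin d → ℝ) (j : Fin d) :
    fderiv ℝ (fun y => grad ℓ y j) x v = Matrix.mulVec (hess ℓ x) v j := by
  rw [fderiv_grad]
  simp only [Matrix.mulVec, dotProduct]
  exact Finset.sum_congr rfl fun i _ => by rw [h.hess_symm]

theorem IsLossFunction.grad_nonneg (hℓ : IsLossFunction ℓ) (h : IsC2 ℓ) (x : Fin d → ℝ)
    (k : Fin d) : 0 ≤ grad ℓ x k := by
  have h1 := hℓ.le_grad_dotProduct (h := Pi.single k 1) (h.diffAt x) one_pos (h.1 _)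
  have h2 : (ℓ (x - (1 : ℝ) • Pi.single k 1)).toReal ≤ (ℓ x).toReal := by
    refine hℓ.toReal_mono (fun i => ?_) (h.1 _)
    by_cases hik : i = k
    · subst hik
      simp
    · simp [hik]
  simp only [dotProduct_single, mul_one, div_one] at h1
  linarith

theorem abs_mem_orliczHeart {X : Ω → Fin d → ℝ} (hX : X ∈ orliczHeart ℓ P) :
    (fun ω => |X ω|) ∈ orliczHeart ℓ P := by
  refine ⟨?_, fun r hr => ?_⟩
  · have hm : Measurable fun x : Fin d → ℝ => |x| := by
      refine measurable_pi_lambda _ fun k => ?_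
      simp only [Pi.abs_apply]
      fun_prop
    exact hm.comp_aemeasurable hX.1
  · have e : ∀ x : Fin d → ℝ, |r • (|x|)| = |r • x| := fun x => by
      ext k
      simp [abs_mul]
    simp only [e]
    exact hX.2 r hr

theorem integrable_hess (hC : IsC2 ℓ) {X Y : Ω → Fin d → ℝ}
    (hX : AEMeasurable X P) (hY : AEMeasurable Y P)
    {m : Fin d → ℝ} (hH : HessDominated ℓ P X Y m) (i j : Fin d) :
    Integrable (fun ω => hess ℓ (X ω - m) i j) P ∧
      Integrable (fun ω => hess ℓ (X ω - m) i j * Y ω j) P := by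
  obtain ⟨δ, hδ, g, hg, hdom⟩ := hH
  have hcont : Continuous fun x => hess ℓ x i j := by
    simp only [hess, Matrix.of_apply]
    exact ((hC.contDiff_grad j).continuous_fderiv one_ne_zero).clm_apply continuous_const
  have hm : AEStronglyMeasurable (fun ω => hess ℓ (X ω - m) i j) P :=
    hcont.comp_aestronglyMeasurable (hX.sub_const m).aestronglyMeasurable
  have hb : ∀ᵐ ω ∂P, |hess ℓ (X ω - m) i j| * (1 + ‖Y ω‖) ≤ g ω := by
    filter_upwards [hdom] with ω hω
    simpa using hω m 0 (by simpa) (by simpa) i j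
  refine ⟨hg.mono' hm ?_, hg.mono' (hm.mul
    ((measurable_pi_apply j).comp_aemeasurable hY).aestronglyMeasurable) ?_⟩
  · filter_upwards [hb] with ω hω
    refine le_trans ?_ hω
    rw [Real.norm_eq_abs]
    exact le_mul_of_one_le_right (abs_nonneg _) (by linarith [norm_nonneg (Y ω)])
  · filter_upwards [hb] with ω hω
    refine le_trans ?_ hω
    rw [Real.norm_eq_abs, abs_mul]
    refine mul_le_mul_of_nonneg_left ?_ (abs_nonneg _)
    have : |Y ω j| ≤ ‖Y ω‖ := norm_le_pi_norm (Y ω) j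
    linarith

theorem integral_mulVec_hess (hC : IsC2 ℓ) {X Y : Ω → Fin d → ℝ}
    (hX : AEMeasurable X P) (hY : AEMeasurable Y P)
    {m : Fin d → ℝ} (hH : HessDominated ℓ P X Y m) (s : ℝ) (n : Fin d → ℝ) (k : Fin d) :
    ∫ ω, Matrix.mulVec (hess ℓ (X ω - m)) (s • Y ω - n) k ∂P =
      s * ∫ ω, Matrix.mulVec (hess ℓ (X ω - m)) (Y ω) k ∂P -
        ∑ j, (∫ ω, hess ℓ (X ω - m) k j ∂P) * n j := by
  have h1 := fun j => (integrable_hess hC hX hY hH k j).1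
  have h2 : Integrable (fun ω => Matrix.mulVec (hess ℓ (X ω - m)) (Y ω) k) P :=
    integrable_finsetSum Finset.univ fun j _ => (integrable_hess hC hX hY hH k j).2
  have e : ∀ ω, Matrix.mulVec (hess ℓ (X ω - m)) (s • Y ω - n) k =
      s * Matrix.mulVec (hess ℓ (X ω - m)) (Y ω) k - ∑ j, hess ℓ (X ω - m) k j * n j := fun ω => by
    rw [Matrix.mulVec_sub, Matrix.mulVec_smul]
    rfl
  simp_rw [e]
  rw [integral_sub (h2.const_mul s) (integrable_finsetSum _ fun j _ => (h1 j).mul_const _),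
    integral_const_mul, integral_finsetSum _ fun j _ => (h1 j).mul_const _]
  simp_rw [integral_mul_const]

variable [IsProbabilityMeasure P]

theorem add_smul_mem_orliczHeart (hℓ : IsLossFunction ℓ) (hfin : ∀ x, ℓ x ≠ ⊤)
    {X Y : Ω → Fin d → ℝ} (hX : X ∈ orliczHeart ℓ P) (hY : Y ∈ orliczHeart ℓ P) (t : ℝ) :
    X + t • Y ∈ orliczHeart ℓ P := by
  have iX := integrable_of_mem_orliczHeart hℓ hX
  have iY := integrable_of_mem_orliczHeart hℓ hY
  refine ⟨hX.1.add (hY.1.const_smul t), fun r hr => ?_⟩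
  have h1 := finExp_affine hℓ hfin (abs_mem_orliczHeart hX) (abs_mem_orliczHeart hY)
    |r| (|r| * |t|) 0
  have h2 : FinExp ℓ P fun ω => |r • (X + t • Y) ω| := by
    refine h1.of_ae_le hℓ (Integrable.pi_abs ((iX.add (iY.smul t)).smul r))
      (Eventually.of_forall fun ω k => ?_)
    simp only [Pi.abs_apply, Pi.smul_apply, Pi.add_apply, smul_eq_mul, Pi.zero_apply, add_zero]
    calc |r * (X ω k + t * Y ω k)| ≤ |r * X ω k| + |r * (t * Y ω k)| := by
          rw [mul_add]
          exact abs_add_le _ _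
      _ = _ := by simp only [abs_mul, mul_assoc]
  rw [expect_eq_integral hℓ h2]
  exact EReal.coe_lt_top _

/-- The expected loss is continuously differentiable under affine perturbations. -/
theorem contDiffAt_expected_loss (hℓ : IsLossFunction ℓ) (hC : IsC2 ℓ)
    {X Y : Ω → Fin d → ℝ} (hX : X ∈ orliczHeart ℓ P) (hY : Y ∈ orliczHeart ℓ P)
    (x₀ : (Fin d → ℝ) × ℝ) :
    ContDiffAt ℝ 1
        (fun x : (Fin d → ℝ) × ℝ => ∫ ω, (ℓ (X ω + x.2 • Y ω - x.1)).toReal ∂P) x₀ ∧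
      ∃ L : (Fin d → ℝ) × ℝ →L[ℝ] ℝ, HasFDerivAt
        (fun x : (Fin d → ℝ) × ℝ => ∫ ω, (ℓ (X ω + x.2 • Y ω - x.1)).toReal ∂P) L x₀ ∧
        ∀ v, L v = ∫ ω, grad ℓ (X ω + x₀.2 • Y ω - x₀.1) ⬝ᵥ (v.2 • Y ω - v.1) ∂P := by
  have iX := integrable_of_mem_orliczHeart hℓ hX
  have iY := integrable_of_mem_orliczHeart hℓ hY
  obtain ⟨c, hc⟩ := hℓ.exists_le_toReal
  set a := |x₀.2| + 1 with ha
  set b := ‖x₀.1‖ + 1 with hb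
  have hU := finExp_affine hℓ hC.1 (abs_mem_orliczHeart hX) (abs_mem_orliczHeart hY) 1 (a + 1)
    (fun _ => b + 1)
  have hlow : Integrable (fun ω => ∑ k, (|X ω k| + a * |Y ω k| + b) + c) P :=
    (integrable_finsetSum _ fun k _ => (((iX.eval k).abs.add
      ((iY.eval k).abs.const_mul a)).add (integrable_const b))).add (integrable_const c)
  -- No Hessian bound is needed here. Since `∇ℓ ≥ 0`, the derivative along `v` is at most `‖v‖ ∇ℓ(z)
  -- · (|Y| + 1) ≤ ‖v‖ (ℓ(z + |Y| + 1) - ℓ(z))`. On the unit ball, `a` and `b` bound `|t|` and the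
  -- components of `m`, which replaces `z` by `|X| + a|Y| + b` in the first term; the affine
  -- minorant controls the second.
  have key := contDiffAt_integral_shift (P := P) (hC.2.of_le one_le_two) hX.1 hY.1 x₀ one_pos
    (g := fun ω => (ℓ ((1 : ℝ) • |X ω| + (a + 1) • |Y ω| + fun _ => b + 1)).toReal +
      (∑ k, (|X ω k| + a * |Y ω k| + b) + c)) (hU.2.add hlow) ?_ ?_
  · simp only [grad_dotProduct]
    exact key
  · intro x _
    exact (finExp_affine hℓ hC.1 hX hY 1 x.2 (-x.1)).congr
      (Eventually.of_forall fun ω => by module) |>.2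
  · refine Eventually.of_forall fun ω x hx v => ?_
    rw [Metric.mem_ball, dist_eq_norm, Prod.norm_def, max_lt_iff] at hx
    obtain ⟨hx1, hx2⟩ := hx
    rw [← grad_dotProduct]
    set z := X ω + x.2 • Y ω - x.1 with hz
    have hxs : |x.2| ≤ a := by
      have h1 := abs_add_le (x.2 - x₀.2) x₀.2
      rw [sub_add_cancel] at h1
      have h2 : |x.2 - x₀.2| < 1 := hx2
      linarith
    have hxn : ∀ k, |x.1 k| ≤ b := fun k => by
      refine (norm_le_pi_norm x.1 k).trans ?_
      have h1 := norm_add_le (x.1 - x₀.1) x₀.1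
      rw [sub_add_cancel] at h1
      have h2 : ‖x.1 - x₀.1‖ < 1 := hx1
      linarith
    have hzk : ∀ k, |z k| ≤ |X ω k| + a * |Y ω k| + b := by
      intro k
      have h1 : |z k| ≤ |X ω k| + |x.2 * Y ω k| + |x.1 k| :=
        (abs_sub _ _).trans (add_le_add_left (abs_add_le _ _) _)
      rw [abs_mul] at h1
      have h2 := mul_le_mul_of_nonneg_right hxs (abs_nonneg (Y ω k))
      linarith [hxn k]
    have hg := hℓ.grad_dotProduct_le (h := |Y ω| + fun _ => (1 : ℝ)) (hC.diffAt z) one_pos (hC.1 _)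
    have h1 : (ℓ (z + (1 : ℝ) • (|Y ω| + fun _ => (1 : ℝ)))).toReal ≤
        (ℓ ((1 : ℝ) • |X ω| + (a + 1) • |Y ω| + fun _ => b + 1)).toReal := by
      refine hℓ.toReal_mono (fun k => ?_) (hC.1 _)
      have := (le_abs_self _).trans (hzk k)
      simp only [Pi.add_apply, Pi.smul_apply, one_smul, Pi.abs_apply, smul_eq_mul]
      linarith
    have h2 : -(∑ k, (|X ω k| + a * |Y ω k| + b) + c) ≤ (ℓ z).toReal := by
      refine le_trans ?_ (hc z (hC.1 _))
      rw [neg_add, ← sub_eq_add_neg, ← Finset.sum_neg_distrib]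
      exact sub_le_sub_right (Finset.sum_le_sum fun k _ =>
        (neg_le_neg (hzk k)).trans (neg_abs_le _)) c
    calc |grad ℓ z ⬝ᵥ (v.2 • Y ω - v.1)|
        ≤ ∑ k, |grad ℓ z k * (v.2 • Y ω - v.1) k| := Finset.abs_sum_le_sum_abs _ _
      _ ≤ ∑ k, grad ℓ z k * (|Y ω k| + 1) * ‖v‖ := by
          refine Finset.sum_le_sum fun k _ => ?_
          rw [abs_mul, abs_of_nonneg (hℓ.grad_nonneg hC z k), mul_assoc]
          refine mul_le_mul_of_nonneg_left ?_ (hℓ.grad_nonneg hC z k)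
          simp only [Pi.sub_apply, Pi.smul_apply, smul_eq_mul]
          have e1 : |v.2| ≤ ‖v‖ := norm_snd_le v
          have e2 : |v.1 k| ≤ ‖v‖ := (norm_le_pi_norm v.1 k).trans (norm_fst_le v)
          have e3 := mul_le_mul_of_nonneg_right e1 (abs_nonneg (Y ω k))
          calc _ ≤ |v.2 * Y ω k| + |v.1 k| := abs_sub _ _
            _ ≤ _ := by rw [abs_mul]; linarith
      _ = (grad ℓ z ⬝ᵥ (|Y ω| + fun _ => (1 : ℝ))) * ‖v‖ := by
          rw [dotProduct, Finset.sum_mul]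
          rfl
      _ ≤ _ := by
          refine mul_le_mul_of_nonneg_right ?_ (norm_nonneg _)
          rw [div_one] at hg
          linarith

/-- The expected gradient is continuously differentiable near `(m, 0)`. -/
theorem contDiffAt_expected_grad (hℓ : IsLossFunction ℓ) (hC : IsC2 ℓ)
    {X Y : Ω → Fin d → ℝ} (hX : X ∈ orliczHeart ℓ P) (hY : Y ∈ orliczHeart ℓ P)
    {m : Fin d → ℝ} (hH : HessDominated ℓ P X Y m) (j : Fin d) :
    ContDiffAt ℝ 1
        (fun x : (Fin d → ℝ) × ℝ => ∫ ω, grad ℓ (X ω + x.2 • Y ω - x.1) j ∂P) (m, 0) ∧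
      ∃ L : (Fin d → ℝ) × ℝ →L[ℝ] ℝ, HasFDerivAt
        (fun x : (Fin d → ℝ) × ℝ => ∫ ω, grad ℓ (X ω + x.2 • Y ω - x.1) j ∂P) L (m, 0) ∧
        ∀ v, L v = ∫ ω, Matrix.mulVec (hess ℓ (X ω - m)) (v.2 • Y ω - v.1) j ∂P := by
  obtain ⟨δ, hδ, g, hg, hdom⟩ := hH
  -- The factor `d` counts the Hessian entries in the sum for one gradient component.
  have key := contDiffAt_integral_shift (P := P) (hC.contDiff_grad j) hX.1 hY.1 (m, 0) hδ
    (g := fun ω => d * g ω) (hg.const_mul _) ?_ ?_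
  · simpa only [hC.fderiv_grad_eq_mulVec, zero_smul, add_zero] using key
  · intro x _
    have hXt := add_smul_mem_orliczHeart hℓ hC.1 hX hY x.2
    exact (regularAt_of_forall_ne_top (m := x.1) hℓ hC.1 hXt hY
      (Eventually.of_forall fun _ => hC.diffAt _)).integrable_grad_apply hℓ
      (integrable_of_mem_orliczHeart hℓ hXt) (integrable_of_mem_orliczHeart hℓ hY) j
  · filter_upwards [hdom] with ω hω x hx v
    rw [Metric.mem_ball, dist_eq_norm, Prod.norm_def, max_lt_iff] at hx
    obtain ⟨hx1, hx2⟩ := hx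
    have hω' := hω x.1 x.2 hx1 (by simpa using hx2)
    rw [fderiv_grad]
    calc _ ≤ ∑ i, |hess ℓ (X ω + x.2 • Y ω - x.1) i j * (v.2 • Y ω - v.1) i| :=
          Finset.abs_sum_le_sum_abs _ _
      _ ≤ ∑ _i : Fin d, g ω * ‖v‖ := by
          refine Finset.sum_le_sum fun i _ => ?_
          have e1 : |v.2| ≤ ‖v‖ := norm_snd_le v
          have e2 : |v.1 i| ≤ ‖v‖ := (norm_le_pi_norm v.1 i).trans (norm_fst_le v)
          have e4 : |Y ω i| ≤ ‖Y ω‖ := norm_le_pi_norm (Y ω) i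
          have e3 := mul_le_mul e1 e4 (abs_nonneg _) (norm_nonneg _)
          have e5 : |(v.2 • Y ω - v.1) i| ≤ (1 + ‖Y ω‖) * ‖v‖ := by
            simp only [Pi.sub_apply, Pi.smul_apply, smul_eq_mul]
            calc _ ≤ |v.2 * Y ω i| + |v.1 i| := abs_sub _ _
              _ ≤ _ := by rw [abs_mul]; linarith
          rw [abs_mul]
          calc _ ≤ |hess ℓ (X ω + x.2 • Y ω - x.1) i j| * ((1 + ‖Y ω‖) * ‖v‖) := by gcongr
            _ = |hess ℓ (X ω + x.2 • Y ω - x.1) i j| * (1 + ‖Y ω‖) * ‖v‖ := by ring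
            _ ≤ _ := mul_le_mul_of_nonneg_right (hω' i j) (norm_nonneg _)
      _ = _ := by simp [mul_assoc]

end Smooth

/-! ### The curve of saddle points by the inverse function theorem. -/

section SaddleCurve

variable {d : ℕ} {ℓ : (Fin d → ℝ) → EReal} {Ω : Type*} [MeasurableSpace Ω] {P : Measure Ω}
  [IsProbabilityMeasure P]

/-- The first order conditions for saddle points of `X + tY`, as a function of `((m, λ), t)`. -/
noncomputable def focMap (ℓ : (Fin d → ℝ) → EReal) (P : Measure Ω) (X Y : Ω → Fin d → ℝ)
    (x : ((Fin d → ℝ) × ℝ) × ℝ) : ((Fin d → ℝ) × ℝ) × ℝ :=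
  ((fun k => x.1.2 * ∫ ω, grad ℓ (X ω + x.2 • Y ω - x.1.1) k ∂P - 1,
    ∫ ω, (ℓ (X ω + x.2 • Y ω - x.1.1)).toReal ∂P), x.2)

/-- Zeros of the first order conditions with positive multiplier are exactly the saddle points. -/
theorem mem_saddleSet_iff_focMap (hℓ : IsLossFunction ℓ) (hC : IsC2 ℓ)
    {X Y : Ω → Fin d → ℝ} (hX : X ∈ orliczHeart ℓ P) (hY : Y ∈ orliczHeart ℓ P) (m : Fin d → ℝ)
    (lam t : ℝ) : (m, lam) ∈ saddleSet ℓ P (X + t • Y) ↔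
      0 < lam ∧ focMap ℓ P X Y ((m, lam), t) = ((0, 0), t) := by
  have hXt := add_smul_mem_orliczHeart hℓ hC.1 hX hY t
  have iXt := integrable_of_mem_orliczHeart hℓ hXt
  have iY := integrable_of_mem_orliczHeart hℓ hY
  have hreg : RegularAt ℓ P (X + t • Y) Y m :=
    regularAt_of_forall_ne_top hℓ hC.1 hXt hY (Eventually.of_forall fun _ => hC.diffAt _)
  have hfoc : focMap ℓ P X Y ((m, lam), t) = ((0, 0), t) ↔
      (∀ k, lam * meanGrad ℓ P (X + t • Y) m k = 1) ∧
        ∫ ω, (ℓ ((X + t • Y) ω - m)).toReal ∂P = 0 := by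
    simp only [focMap, Prod.mk.injEq, and_true, funext_iff, Pi.zero_apply, sub_eq_zero]
    rfl
  rw [hfoc]
  constructor
  · intro h
    exact ⟨h.1, hreg.mul_meanGrad_eq_one hℓ iXt iY h,
      (isRiskAllocation_of_mem_saddleSet hℓ iXt ⟨m, hreg.finExp⟩ h).2.2⟩
  · rintro ⟨h1, h2, h3⟩
    exact hreg.mem_saddleSet hℓ iXt iY h1 h3 h2

/-- Acceptability is convex and two risk allocations have equal totals. This brings a second risk
allocation arbitrarily close to the first, into the range of local injectivity. -/
theorem IsRiskAllocation.convex (hℓ : IsLossFunction ℓ) {X : Ω → Fin d → ℝ} (iX : Integrable X P)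
    {m n : Fin d → ℝ} (hm : IsRiskAllocation ℓ P X m) (hn : IsRiskAllocation ℓ P X n) {s : ℝ}
    (hs0 : 0 ≤ s) (hs1 : s ≤ 1) : IsRiskAllocation ℓ P X (m + s • (n - m)) := by
  obtain ⟨h1, h2⟩ := (mem_acceptable_iff hℓ iX m).1 hm.1
  obtain ⟨h3, h4⟩ := (mem_acceptable_iff hℓ iX n).1 hn.1
  have h5 := FinExp.convex hℓ h1 h3 (integrable_sub_const iX m) (integrable_sub_const iX n)
    (sub_nonneg.2 hs1) hs0 (by ring)
  have e : ∀ ω, (1 - s) • (X ω - m) + s • (X ω - n) = X ω - (m + s • (n - m)) :=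
    fun ω => by module
  simp only [e] at h5
  refine ⟨(mem_acceptable_iff hℓ iX _).2 ⟨h5.1, by nlinarith [h5.2]⟩, ?_⟩
  rw [hm.2, EReal.coe_eq_coe_iff]
  have h6 := le_antisymm (hm.sum_le hn.1) (hn.sum_le hm.1)
  simp [Finset.sum_add_distrib, ← Finset.mul_sum, h6]

/-- The first order conditions are continuously differentiable at a saddle point, with derivative
given by the bordered matrix. -/
theorem contDiffAt_focMap (hℓ : IsLossFunction ℓ) (hC : IsC2 ℓ)
    {X Y : Ω → Fin d → ℝ} (hX : X ∈ orliczHeart ℓ P) (hY : Y ∈ orliczHeart ℓ P) {m : Fin d → ℝ}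
    {lam : ℝ} (hs : (m, lam) ∈ saddleSet ℓ P X) (hH : HessDominated ℓ P X Y m) :
    ContDiffAt ℝ 1 (focMap ℓ P X Y) ((m, lam), 0) ∧
      ∃ L : ((Fin d → ℝ) × ℝ) × ℝ →L[ℝ] ((Fin d → ℝ) × ℝ) × ℝ,
        HasFDerivAt (focMap ℓ P X Y) L ((m, lam), 0) ∧
        ∀ v, L v = ((fun k => -Matrix.mulVec (borderedMatrix ℓ P X m lam)
              (Sum.elim v.1.1 fun _ => v.1.2) (Sum.inl k) +
              v.2 * (lam * ∫ ω, Matrix.mulVec (hess ℓ (X ω - m)) (Y ω) k ∂P),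
            (v.2 * gradTerm ℓ P X Y m lam - Matrix.mulVec (borderedMatrix ℓ P X m lam)
              (Sum.elim v.1.1 fun _ => v.1.2) (Sum.inr ())) / lam), v.2) := by
  have iX := integrable_of_mem_orliczHeart hℓ hX
  have iY := integrable_of_mem_orliczHeart hℓ hY
  have hreg : RegularAt ℓ P X Y m :=
    regularAt_of_forall_ne_top hℓ hC.1 hX hY (Eventually.of_forall fun _ => hC.diffAt _)
  have hp := hreg.mul_meanGrad_eq_one hℓ iX iY hs
  have hlam : 0 < lam := hs.1
  -- This turns the gradient entries of the derivative into the constant border. The binding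
  -- constraint contributes the row `-(1/λ) 1ᵀ`, hence the division by `λ` of the last row of `M`.
  have hp' : ∀ k, meanGrad ℓ P X m k = 1 / lam := fun k => by
    rw [eq_div_iff hlam.ne', mul_comm, hp]
  obtain ⟨hG1, LG, hG2, hG3⟩ := contDiffAt_expected_loss hℓ hC hX hY (m, 0)
  have hg := contDiffAt_expected_grad hℓ hC hX hY hH
  choose hg1 Lg hg2 hg3 using hg
  set π : ((Fin d → ℝ) × ℝ) × ℝ →L[ℝ] (Fin d → ℝ) × ℝ :=
    ((ContinuousLinearMap.fst ℝ (Fin d → ℝ) ℝ).comp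
      (ContinuousLinearMap.fst ℝ ((Fin d → ℝ) × ℝ) ℝ)).prod
      (ContinuousLinearMap.snd ℝ ((Fin d → ℝ) × ℝ) ℝ) with hπ
  set Λ : ((Fin d → ℝ) × ℝ) × ℝ →L[ℝ] ℝ := (ContinuousLinearMap.snd ℝ (Fin d → ℝ) ℝ).comp
      (ContinuousLinearMap.fst ℝ ((Fin d → ℝ) × ℝ) ℝ) with hΛ
  set x₀ : ((Fin d → ℝ) × ℝ) × ℝ := ((m, lam), 0) with hx₀
  have cG : ContDiffAt ℝ 1 (fun x : ((Fin d → ℝ) × ℝ) × ℝ =>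
      ∫ ω, (ℓ (X ω + x.2 • Y ω - x.1.1)).toReal ∂P) x₀ :=
    ContDiffAt.comp (f := π) x₀ hG1 π.contDiff.contDiffAt
  have dG : HasFDerivAt (fun x : ((Fin d → ℝ) × ℝ) × ℝ =>
      ∫ ω, (ℓ (X ω + x.2 • Y ω - x.1.1)).toReal ∂P) (LG.comp π) x₀ :=
    HasFDerivAt.comp (f := π) x₀ hG2 π.hasFDerivAt
  have cg : ∀ k, ContDiffAt ℝ 1 (fun x : ((Fin d → ℝ) × ℝ) × ℝ =>
      ∫ ω, grad ℓ (X ω + x.2 • Y ω - x.1.1) k ∂P) x₀ := fun k =>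
    ContDiffAt.comp (f := π) x₀ (hg1 k) π.contDiff.contDiffAt
  have dg : ∀ k, HasFDerivAt (fun x : ((Fin d → ℝ) × ℝ) × ℝ =>
      ∫ ω, grad ℓ (X ω + x.2 • Y ω - x.1.1) k ∂P) ((Lg k).comp π) x₀ := fun k =>
    HasFDerivAt.comp (f := π) x₀ (hg2 k) π.hasFDerivAt
  have dΛ : HasFDerivAt (fun x : ((Fin d → ℝ) × ℝ) × ℝ => x.1.2) Λ x₀ := Λ.hasFDerivAt
  have cΛ : ContDiffAt ℝ 1 (fun x : ((Fin d → ℝ) × ℝ) × ℝ => x.1.2) x₀ := Λ.contDiff.contDiffAt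
  refine ⟨((contDiffAt_pi.2 fun k => (cΛ.mul (cg k)).sub contDiffAt_const).prodMk cG).prodMk
    contDiff_snd.contDiffAt, _,
    ((hasFDerivAt_pi.2 fun k => (dΛ.mul (dg k)).sub_const 1).prodMk dG).prodMk hasFDerivAt_snd,
    fun v => ?_⟩
  have e1 : LG (π v) = v.2 * ∫ ω, grad ℓ (X ω - m) ⬝ᵥ Y ω ∂P - (∑ k, v.1.1 k) / lam := by
    rw [hG3]
    simp only [zero_smul, add_zero]
    rw [hreg.integral_grad_dotProduct hℓ iX iY]
    simp only [hp']
    rw [← Finset.mul_sum]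
    simp [hπ]
    ring
  have e2 : ∀ k, Lg k (π v) = v.2 * ∫ ω, Matrix.mulVec (hess ℓ (X ω - m)) (Y ω) k ∂P -
        ∑ j, (∫ ω, hess ℓ (X ω - m) k j ∂P) * v.1.1 j := fun k => by
    rw [hg3, integral_mulVec_hess hC hX.1 hY.1 hH]
    rfl
  have e3 : ∀ k, ∫ ω, grad ℓ (X ω + x₀.2 • Y ω - x₀.1.1) k ∂P = 1 / lam := fun k => by
    rw [← hp' k]
    simp [hx₀, meanGrad]
  have e4 : ∀ k, Matrix.mulVec (borderedMatrix ℓ P X m lam) (Sum.elim v.1.1 fun _ => v.1.2)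
      (Sum.inl k) = lam * ∑ j, (∫ ω, hess ℓ (X ω - m) k j ∂P) * v.1.1 j - v.1.2 / lam := by
    intro k
    simp [borderedMatrix, Matrix.mulVec, dotProduct, Finset.mul_sum, mul_assoc, sub_eq_add_neg,
      div_eq_inv_mul]
  have e5 : Matrix.mulVec (borderedMatrix ℓ P X m lam) (Sum.elim v.1.1 fun _ => v.1.2)
      (Sum.inr ()) = ∑ k, v.1.1 k := by
    simp [borderedMatrix, Matrix.mulVec, dotProduct]
  refine Prod.ext (Prod.ext (funext fun k => ?_) ?_) rfl
  · have : ((lam • (Lg k).comp π + (∫ ω, grad ℓ (X ω + x₀.2 • Y ω - x₀.1.1) k ∂P) • Λ) v : ℝ) =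
        lam * Lg k (π v) + (1 / lam) * v.1.2 := by
      rw [e3]
      rfl
    refine this.trans ?_
    simp only [e2, e4]
    ring
  · change LG (π v) = _
    rw [e1, e5, gradTerm]
    field_simp

/-- The saddle points of `X + tY` form a differentiable curve. -/
theorem exists_saddle_curve (hd : 0 < d) (hℓ : IsLossFunction ℓ) (hC : IsC2 ℓ)
    {X Y : Ω → Fin d → ℝ} (hX : X ∈ orliczHeart ℓ P) (hY : Y ∈ orliczHeart ℓ P) {m : Fin d → ℝ}
    {lam : ℝ} (hs : (m, lam) ∈ saddleSet ℓ P X) (hH : HessDominated ℓ P X Y m)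
    (hM : IsUnit (borderedMatrix ℓ P X m lam)) :
    ∃ c : ℝ → (Fin d → ℝ) × ℝ, ∃ c' : (Fin d → ℝ) × ℝ, ∃ ε : ℝ, 0 < ε ∧
      (∀ t ∈ Ioo (-ε) ε, DifferentiableAt ℝ c t ∧ saddleSet ℓ P (X + t • Y) = {c t} ∧
        ∀ n, IsRiskAllocation ℓ P (X + t • Y) n ↔ n = (c t).1) ∧
      HasDerivAt c c' 0 ∧
      Matrix.mulVec (borderedMatrix ℓ P X m lam) (Sum.elim c'.1 fun _ => c'.2) =
        Sum.elim (fun k => lam * ∫ ω, Matrix.mulVec (hess ℓ (X ω - m)) (Y ω) k ∂P)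
          fun _ => gradTerm ℓ P X Y m lam := by
  obtain ⟨hΦ, L, hL, hLv⟩ := contDiffAt_focMap hℓ hC hX hY hs hH
  have hlam : 0 < lam := hs.1
  have hx₀ : focMap ℓ P X Y ((m, lam), 0) = ((0, 0), 0) :=
    ((mem_saddleSet_iff_focMap hℓ hC hX hY m lam 0).1 (by simpa using hs)).2
  -- The adjoined component forces `v.2 = 0`, and what remains is the kernel of the bordered matrix.
  have hinj : Function.Injective L := by
    rw [injective_iff_map_eq_zero]
    intro v hv
    rw [hLv] at hv
    obtain ⟨h12, h3⟩ := Prod.ext_iff.1 hv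
    obtain ⟨h1, h2⟩ := Prod.ext_iff.1 h12
    simp only [Prod.snd_zero, Prod.fst_zero] at h1 h2 h3
    have h4 : Matrix.mulVec (borderedMatrix ℓ P X m lam)
        (Sum.elim v.1.1 fun _ => v.1.2) = 0 := by
      ext i
      rcases i with k | u
      · have := congrFun h1 k
        simp only [h3, zero_mul, add_zero, Pi.zero_apply, neg_eq_zero] at this
        exact this
      · simpa [h3, hlam.ne'] using h2
    have h5 : (Sum.elim v.1.1 fun _ => v.1.2 : Fin d ⊕ Unit → ℝ) = 0 :=
      Matrix.mulVec_injective_of_isUnit hM (by rw [h4, Matrix.mulVec_zero])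
    refine Prod.ext (Prod.ext (funext fun k => ?_) ?_) h3
    · exact congrFun h5 (Sum.inl k)
    · exact congrFun h5 (Sum.inr ())
  set e' : (((Fin d → ℝ) × ℝ) × ℝ) ≃L[ℝ] ((Fin d → ℝ) × ℝ) × ℝ :=
    (LinearEquiv.ofInjectiveEndo L.toLinearMap hinj).toContinuousLinearEquiv with he'
  have he'L : (e' : (((Fin d → ℝ) × ℝ) × ℝ) →L[ℝ] ((Fin d → ℝ) × ℝ) × ℝ) = L := by
    ext1 <;> rfl
  have hL' : HasFDerivAt (focMap ℓ P X Y)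
      (e' : (((Fin d → ℝ) × ℝ) × ℝ) →L[ℝ] ((Fin d → ℝ) × ℝ) × ℝ) ((m, lam), 0) := by
    rwa [he'L]
  set e := hΦ.toOpenPartialHomeomorph (focMap ℓ P X Y) hL' one_ne_zero with he
  have hecoe : ∀ x, e x = focMap ℓ P X Y x := fun _ => rfl
  have hmem : ((m, lam), 0) ∈ e.source := hΦ.mem_toOpenPartialHomeomorph_source hL' one_ne_zero
  have hsymm : ContDiffAt ℝ 1 e.symm ((0, 0), 0) := by
    rw [← hx₀]
    exact hΦ.to_localInverse hL' one_ne_zero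
  have hsymm0 : e.symm ((0, 0), 0) = ((m, lam), 0) := by
    rw [← hx₀, ← hecoe]
    exact e.left_inv hmem
  have htarget : (((0, 0), 0) : ((Fin d → ℝ) × ℝ) × ℝ) ∈ e.target := by
    rw [← hx₀, ← hecoe]
    exact e.map_source hmem
  -- The curve is the preimage of this line under the local inverse.
  set y : ℝ → ((Fin d → ℝ) × ℝ) × ℝ := fun t => ((0, 0), t) with hy
  have hycd : ContDiff ℝ 1 y := by fun_prop
  have hyc : Tendsto y (𝓝 0) (𝓝 ((0, 0), 0)) := hycd.continuous.tendsto 0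
  have hcd : ContDiffAt ℝ 1 (fun t => (e.symm (y t)).1) 0 :=
    contDiff_fst.contDiffAt.comp (0 : ℝ) (hsymm.comp (0 : ℝ) hycd.contDiffAt)
  have hev1 : ∀ᶠ t in 𝓝 (0 : ℝ), DifferentiableAt ℝ (fun t => (e.symm (y t)).1) t :=
    (hcd.eventually (by simp)).mono fun t ht => ht.differentiableAt one_ne_zero
  have hev2 : ∀ᶠ t in 𝓝 (0 : ℝ), y t ∈ e.target := hyc.eventually (e.open_target.mem_nhds htarget)
  have hev3 : ∀ᶠ t in 𝓝 (0 : ℝ), 0 < (e.symm (y t)).1.2 := by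
    have h1 : Tendsto (fun t => (e.symm (y t)).1.2) (𝓝 0) (𝓝 lam) := by
      have h2 := (continuous_snd.tendsto _).comp hcd.continuousAt.tendsto
      rw [hsymm0] at h2
      exact h2
    exact h1.eventually_const_lt hlam
  obtain ⟨ε, hε, hball⟩ := Metric.eventually_nhds_iff.1 (hev1.and (hev2.and hev3))
  have hfoc : ∀ t, y t ∈ e.target → e.symm (y t) = ((e.symm (y t)).1, t) ∧
      focMap ℓ P X Y ((e.symm (y t)).1, t) = y t := by
    intro t ht
    have h1 : focMap ℓ P X Y (e.symm (y t)) = y t := e.right_inv ht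
    have h2 : (e.symm (y t)).2 = t := congrArg Prod.snd h1
    have h3 : e.symm (y t) = ((e.symm (y t)).1, t) := Prod.ext rfl h2
    exact ⟨h3, by rw [← h3]; exact h1⟩
  refine ⟨fun t => (e.symm (y t)).1, deriv (fun t => (e.symm (y t)).1) 0, ε, hε, ?_,
    (hcd.differentiableAt one_ne_zero).hasDerivAt, ?_⟩
  · intro t ht
    have hb := @hball t (by rw [Real.dist_eq, sub_zero]; exact abs_lt.2 ht)
    obtain ⟨hdiff, htar, hpos⟩ := hb
    obtain ⟨h1, h2⟩ := hfoc t htar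
    have hXt := add_smul_mem_orliczHeart hℓ hC.1 hX hY t
    have iXt := integrable_of_mem_orliczHeart hℓ hXt
    set p := (e.symm (y t)).1 with hp
    have hsad : (p.1, p.2) ∈ saddleSet ℓ P (X + t • Y) :=
      (mem_saddleSet_iff_focMap hℓ hC hX hY p.1 p.2 t).2 ⟨hpos, h2⟩
    have hS : ∃ m', FinExp ℓ P (fun ω => (X + t • Y) ω - m') := ⟨0, finExp_sub hℓ hC.1 hXt 0⟩
    have hpr := (isRiskAllocation_of_mem_saddleSet hℓ iXt hS hsad).1
    -- Points of the segment from `p.1` to `n` near `p.1` are risk allocations that share the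
    -- multiplier `p.2`, hence zeros in the source of the local inverse; injectivity there forces `n
    -- = p.1`.
    have huniq : ∀ n, IsRiskAllocation ℓ P (X + t • Y) n → n = p.1 := by
      intro n hn
      have hsrc : ∀ᶠ s in 𝓝[>] (0 : ℝ), ((p.1 + s • (n - p.1), p.2), t) ∈ e.source := by
        have hcont : Continuous fun s : ℝ => (((p.1 + s • (n - p.1), p.2), t) :
          ((Fin d → ℝ) × ℝ) × ℝ) := by fun_prop
        have h3 : Tendsto (fun s : ℝ => (((p.1 + s • (n - p.1), p.2), t) :
            ((Fin d → ℝ) × ℝ) × ℝ)) (𝓝 0) (𝓝 (e.symm (y t))) := by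
          have := hcont.tendsto 0
          rw [h1]
          simpa using this
        exact (h3.eventually (e.open_source.mem_nhds (e.map_target htar))).filter_mono
          nhdsWithin_le_nhds
      obtain ⟨s, hs1, hs2⟩ := (hsrc.and (Ioc_mem_nhdsGT one_pos)).exists
      have h4 := (hpr.convex hℓ iXt hn hs2.1.le hs2.2).mem_saddleSet hℓ iXt hS hsad
      have h5 := ((mem_saddleSet_iff_focMap hℓ hC hX hY _ _ t).1 h4).2
      have h6 := e.injOn hs1 (e.map_target htar) (h5.trans (e.right_inv htar).symm)
      rw [h1] at h6
      have h7 : p.1 + s • (n - p.1) = p.1 := congrArg (fun x => x.1.1) h6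
      rw [add_eq_left, smul_eq_zero, sub_eq_zero] at h7
      exact h7.resolve_left hs2.1.ne'
    refine ⟨hdiff, ?_, fun n => ⟨huniq n, fun h => h ▸ hpr⟩⟩
    refine Set.eq_singleton_iff_unique_mem.2 ⟨hsad, ?_⟩
    rintro ⟨n, l⟩ hnl
    have hn := huniq n (isRiskAllocation_of_mem_saddleSet hℓ iXt hS hnl).1
    subst hn
    have h3 := ((mem_saddleSet_iff_focMap hℓ hC hX hY _ _ t).1 hnl).2
    -- Once `m` is fixed, any one gradient equation determines the multiplier; `d > 0` provides one.
    have h4 : p.2 * ∫ ω, grad ℓ (X ω + t • Y ω - p.1) ⟨0, hd⟩ ∂P - 1 = 0 :=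
      congrArg (fun x => x.1.1 ⟨0, hd⟩) h2
    have h5 : l * ∫ ω, grad ℓ (X ω + t • Y ω - p.1) ⟨0, hd⟩ ∂P - 1 = 0 :=
      congrArg (fun x => x.1.1 ⟨0, hd⟩) h3
    refine Prod.ext rfl (mul_right_cancel₀ (b := ∫ ω, grad ℓ (X ω + t • Y ω - p.1) ⟨0, hd⟩ ∂P)
      (fun h0 => ?_) (by linarith))
    rw [h0] at h4
    simp at h4
  · set c' := deriv (fun t => (e.symm (y t)).1) 0
    have h1 : HasDerivAt (fun t => ((e.symm (y t)).1, t)) (c', (1 : ℝ)) 0 :=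
      (hcd.differentiableAt one_ne_zero).hasDerivAt.prodMk (hasDerivAt_id 0)
    have h2 : HasDerivAt (fun t => focMap ℓ P X Y ((e.symm (y t)).1, t)) (L (c', 1)) 0 := by
      have h0 : (e.symm (y 0)).1 = (m, lam) := congrArg Prod.fst hsymm0
      have hL0 : HasFDerivAt (focMap ℓ P X Y) L
          ((fun t => ((e.symm (y t)).1, t)) (0 : ℝ)) := by
        simp only [h0]
        exact hL
      exact HasFDerivAt.comp_hasDerivAt (f := fun t => ((e.symm (y t)).1, t)) (0 : ℝ) hL0 h1
    have h3 : HasDerivAt y (((0, 0), 1) : ((Fin d → ℝ) × ℝ) × ℝ) 0 :=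
      (hasDerivAt_const 0 _).prodMk (hasDerivAt_id 0)
    -- Along the curve the conditions equal `y`, so the chain rule gives `L (c', 1) = ((0, 0), 1)`,
    -- which is the linear system for `c'`.
    have h4 := h2.unique (h3.congr_of_eventuallyEq (hev2.mono fun t ht => (hfoc t ht).2))
    rw [hLv] at h4
    obtain ⟨h5, h6⟩ := Prod.ext_iff.1 (congrArg Prod.fst h4)
    simp only at h5 h6
    ext i
    rcases i with k | u
    · have := congrFun h5 k
      simp only [Pi.zero_apply, one_mul] at this
      rw [Sum.elim_inl]
      linarith
    · rw [div_eq_zero_iff] at h6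
      have := h6.resolve_right hlam.ne'
      rw [Sum.elim_inr]
      linarith

end SaddleCurve

/-! ### Assembly of the main theorem. -/

theorem limsup_eq_of_hasDerivWithinAt {f : ℝ → ℝ} {f' : ℝ}
    (h : HasDerivWithinAt f f' (Ici 0) 0) :
    limsup (fun t : ℝ => (((f t - f 0) / t : ℝ) : EReal)) (𝓝[>] (0 : ℝ)) = (f' : EReal) := by
  have h1 := hasDerivWithinAt_iff_tendsto_slope.1 h
  rw [Ici_sdiff_left] at h1
  refine Tendsto.limsup_eq (((continuous_coe_real_ereal.tendsto f').comp h1).congr fun t => ?_)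
  simp [slope_def_field]

end ShortfallRisk

open ShortfallRisk in
theorem mainTheorem3 {Ω : Type*} [MeasurableSpace Ω] (P : Measure Ω) [IsProbabilityMeasure P]
    {d : ℕ} (hd : 0 < d) (ℓ : (Fin d → ℝ) → EReal) (hℓ : IsLossFunction ℓ)
    (hperm : PermutationInvariant ℓ) (X Y : Ω → Fin d → ℝ)
    (hX : X ∈ orliczHeart ℓ P) (hY : Y ∈ orliczHeart ℓ P)
    -- the gradient in the formula for `R(X;Y)` is defined
    (hdiff : ∀ m, IsRiskAllocation ℓ P X m → ∀ᵐ ω ∂P, DiffAt ℓ (X ω - m)) :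
    -- `R(X;Y) = min_{m ∈ B(X)} max_{λ ∈ C(X)} λ E[∇ℓ(X - m) · Y]`, both extrema being attained
    ((∀ m ∈ saddleB ℓ P X, Integrable (fun ω => grad ℓ (X ω - m) ⬝ᵥ Y ω) P) ∧
      (∀ m ∈ saddleB ℓ P X, ∃ s, IsGreatest (gradTerm ℓ P X Y m '' saddleC ℓ P X) s) ∧
      ∃ r : ℝ, marginalRisk ℓ P X Y = (r : EReal) ∧
        IsLeast {s | ∃ m ∈ saddleB ℓ P X,
          IsGreatest (gradTerm ℓ P X Y m '' saddleC ℓ P X) s} r) ∧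
    -- the saddle point of `X + tY` is unique for small `t` and differentiable in `t`
    (IsC2 ℓ → ∀ m lam, (m, lam) ∈ saddleB ℓ P X ×ˢ saddleC ℓ P X →
      HessDominated ℓ P X Y m → IsUnit (borderedMatrix ℓ P X m lam) →
      ∃ t₀ : ℝ, 0 < t₀ ∧ ∃ mult : ℝ → ℝ,
        (∀ t ∈ Set.Icc 0 t₀, (∃! m', IsRiskAllocation ℓ P (X + t • Y) m') ∧
          saddleB ℓ P (X + t • Y) ×ˢ saddleC ℓ P (X + t • Y) =
            {(riskAllocation ℓ P (X + t • Y), mult t)}) ∧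
        DifferentiableOn ℝ (fun t : ℝ => (riskAllocation ℓ P (X + t • Y), mult t))
          (Set.Icc 0 t₀) ∧
        (∀ k, HasDerivWithinAt (fun t : ℝ => riskAllocation ℓ P (X + t • Y) k)
            (Matrix.mulVec (borderedMatrix ℓ P X m lam)⁻¹ (rhsVector ℓ P X Y m lam) (Sum.inl k))
            (Set.Ici 0) 0 ∧
          riskAllocationMarginal ℓ P X Y k =
            ((Matrix.mulVec (borderedMatrix ℓ P X m lam)⁻¹
              (rhsVector ℓ P X Y m lam) (Sum.inl k) : ℝ) : EReal)) ∧
        HasDerivWithinAt mult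
          (Matrix.mulVec (borderedMatrix ℓ P X m lam)⁻¹ (rhsVector ℓ P X Y m lam) (Sum.inr ()))
          (Set.Ici 0) 0 ∧
        limsup (fun t : ℝ => (((mult t - mult 0) / t : ℝ) : EReal)) (𝓝[>] (0 : ℝ)) =
          ((Matrix.mulVec (borderedMatrix ℓ P X m lam)⁻¹
            (rhsVector ℓ P X Y m lam) (Sum.inr ()) : ℝ) : EReal)) := by
  obtain ⟨hI, hG, ⟨m₀, hm₀⟩, hr⟩ := marginalRisk_formula hd hℓ hperm hX hY hdiff
  refine ⟨⟨hI, fun m hm => ⟨_, hG m hm⟩, _, hr, ⟨m₀, hm₀, hG m₀ hm₀⟩, ?_⟩, ?_⟩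
  · rintro s ⟨m, hm, hs⟩
    exact ((hG m hm).unique hs).le
  intro hC m lam hml hH hM
  have hs : (m, lam) ∈ saddleSet ℓ P X := by rwa [saddleSet_eq_prod]
  obtain ⟨c, c', ε, hε, hc, hc', hMc⟩ := exists_saddle_curve hd hℓ hC hX hY hs hH hM
  have hq : gradTerm ℓ P X Y m lam = (marginalRisk ℓ P X Y).toReal := by
    have iX := integrable_of_mem_orliczHeart hℓ hX
    have iY := integrable_of_mem_orliczHeart hℓ hY
    have hreg : RegularAt ℓ P X Y m :=
      regularAt_of_forall_ne_top hℓ hC.1 hX hY (Eventually.of_forall fun _ => hC.diffAt _)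
    obtain ⟨h1, h2, h3⟩ := isRiskAllocation_of_mem_saddleSet hℓ iX ⟨m, hreg.finExp⟩ hs
    rw [hreg.marginalRisk_eq hd hℓ iX iY hs.1 h1 h3 (hreg.mul_meanGrad_eq_one hℓ iX iY hs),
      EReal.toReal_coe]
  have hsol : Matrix.mulVec (borderedMatrix ℓ P X m lam)⁻¹ (rhsVector ℓ P X Y m lam) =
      Sum.elim c'.1 fun _ => c'.2 := by
    have : rhsVector ℓ P X Y m lam = Matrix.mulVec (borderedMatrix ℓ P X m lam)
        (Sum.elim c'.1 fun _ => c'.2) := by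
      rw [hMc, rhsVector, hq]
    rw [this, Matrix.mulVec_mulVec, Matrix.nonsing_inv_mul _
      ((Matrix.isUnit_iff_isUnit_det _).1 hM), Matrix.one_mulVec]
  have hIoo : ∀ t ∈ Set.Icc 0 (ε / 2), t ∈ Set.Ioo (-ε) ε := fun t ht =>
    ⟨by linarith [ht.1], by linarith [ht.2]⟩
  -- The chosen allocation is identified with the curve by existence and uniqueness.
  have hRA : ∀ t ∈ Set.Ioo (-ε) ε, riskAllocation ℓ P (X + t • Y) = (c t).1 := fun t ht =>
    ((hc t ht).2.2 _).1 (Classical.epsilon_spec ⟨(c t).1, ((hc t ht).2.2 _).2 rfl⟩)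
  have hmem0 : (0 : ℝ) ∈ Set.Ioo (-ε) ε := ⟨neg_lt_zero.2 hε, hε⟩
  have hd1 : ∀ k, HasDerivWithinAt (fun t : ℝ => riskAllocation ℓ P (X + t • Y) k)
      (Matrix.mulVec (borderedMatrix ℓ P X m lam)⁻¹ (rhsVector ℓ P X Y m lam) (Sum.inl k))
      (Set.Ici 0) 0 := by
    intro k
    rw [hsol]
    have h1 : HasDerivAt (fun t => (c t).1 k) (c'.1 k) 0 :=
      hasDerivAt_pi.1 (hasFDerivAt_fst.comp_hasDerivAt (0 : ℝ) hc') k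
    refine (h1.congr_of_eventuallyEq ?_).hasDerivWithinAt
    filter_upwards [Ioo_mem_nhds hmem0.1 hmem0.2] with t ht
    rw [hRA t ht]
  have hd2 : HasDerivWithinAt (fun t => (c t).2)
      (Matrix.mulVec (borderedMatrix ℓ P X m lam)⁻¹ (rhsVector ℓ P X Y m lam) (Sum.inr ()))
      (Set.Ici 0) 0 := by
    rw [hsol]
    exact (hasFDerivAt_snd.comp_hasDerivAt (0 : ℝ) hc').hasDerivWithinAt
  -- Halving `ε` places the closed interval inside the open one, so the curve is differentiable on
  -- both sides even at the end points.
  refine ⟨ε / 2, half_pos hε, fun t => (c t).2, fun t ht => ⟨⟨(c t).1, ?_, ?_⟩, ?_⟩, ?_,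
    fun k => ⟨hd1 k, ?_⟩, hd2, limsup_eq_of_hasDerivWithinAt hd2⟩
  · exact ((hc t (hIoo t ht)).2.2 _).2 rfl
  · exact fun n hn => ((hc t (hIoo t ht)).2.2 n).1 hn
  · rw [← saddleSet_eq_prod, (hc t (hIoo t ht)).2.1, hRA t (hIoo t ht)]
  · intro t ht
    refine (hc t (hIoo t ht)).1.differentiableWithinAt.congr (fun u hu => ?_) ?_
    · rw [hRA u (hIoo u hu)]
    · rw [hRA t (hIoo t ht)]
  · have := limsup_eq_of_hasDerivWithinAt (hd1 k)
    simp only [zero_smul, add_zero] at this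
    exact this
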